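/- **Setting.** For each layer $\ell\ge 0$ let $I_\ell$ be an arbitrary set of positions, and let every $p\in I_{\ell+1}$ have a finite set of parents $P(p)\subset I_\ell$. For each $\ell$ an equivalence relation on the connections $q\to p$ ($p\in I_{\ell+1}$, $q\in P(p)$) says which connections share their weight matrix; two different connections $q\to p$, $q'\to p$ into the same position are never shared. Let $\chi(q\to p,q'\to p')$ be $1$ if the two connections are shared and $0$ otherwise. Let $0\le\beta\le 1$, and let $\sigma:\mathbb R\to\mathbb R$ be measurable with $\mathbb E[\sigma(Z)^2]<\infty$ for every centered Gaussian variable $Z$. The network with widths $n_0,n_1,n_2,\dots$ has inputs $x=(x_q)_{q\in I_0}\in(\mathbb R^{n_0})^{I_0}$ and preactivations $$\tilde\alpha^{(1,p)}(x)=\beta b^{(0)}+\frac{\sqrt{1-\beta^2}}{\sqrt{|P(p)|n_0}}\sum_{q\in P(p)}W^{(0,q\to p)}x_q,\qquad \tilde\alpha^{(\ell+1,p)}(x)=\beta b^{(\ell)}+\frac{\sqrt{1-\beta^2}}{\sqrt{|P(p)|n_\ell}}\sum_{q\in P(p)}W^{(\ell,q\to p)}\sigma\big(\tilde\alpha^{(\ell,q)}(x)\big)\quad(\ell\ge1),$$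 where $\sigma$ acts entrywise (sums over an empty set contribute $0$). The bias vectors $b^{(\ell)}\in\mathbb R^{n_{\ell+1}}$, common to all positions, and one $n_{\ell+1}\times n_\ell$ matrix for each class of shared connections (with $W^{(\ell,q\to p)}$ the matrix of the class of $q\to p$) have i.i.d. $\mathcal N(0,1)$ entries. Define recursively, for $\ell\ge 1$, $$\Sigma^{(1,pp')}(x,y)=\beta^2+\frac{1-\beta^2}{\sqrt{|P(p)||P(p')|}\,n_0}\sum_{q\in P(p)}\sum_{q'\in P(p')}\chi(q\to p,q'\to p')\,(x_q)^{T}y_{q'},$$ $$\Sigma^{(\ell+1,pp')}(x,y)=\beta^2+\frac{1-\beta^2}{\sqrt{|P(p)||P(p')|}}\sum_{q\in P(p)}\sum_{q'\in P(p')}\chi(q\to p,q'\to p')\,\mathbb E\big[\sigma(u)\sigma(v)\big],$$ where in the term indexed by $(q,q')$ the pair $(u,v)$ is centered Gaussian with covariance matrix $$\begin{pmatrix}\Sigma^{(\ell,qq)}(x,x)&\Sigma^{(\ell,qq')}(x,y)\\ \Sigma^{(\ell,q'q)}(y,x)&\Sigma^{(\ell,q'q')}(y,y)\end{pmatrix}.$$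 **Proposition.** For every $\ell\ge1$, as $n_1\to\infty,\dots,n_{\ell-1}\to\infty$ sequentially, the preactivations $\big(\tilde\alpha^{(\ell,p)}_i(x)\big)_{i,p,x}$ of layer $\ell$ converge, in the sense of finite-dimensional distributions, to a centered Gaussian process with covariance $\Sigma^{(\ell,pp')}(x,y)\,\delta_{ii'}$. That is, for every finite family of channels, positions and inputs $(i_a,p_a,x_a)_{a=1,\dots,m}$, the matrix $M=\big(\Sigma^{(\ell,p_ap_b)}(x_a,x_b)\,\delta_{i_ai_b}\big)_{a,b}$ is symmetric positive semidefinite, and the iterated weak limit $$\lim_{n_{\ell-1}\to\infty}\cdots\lim_{n_1\to\infty}\ \mathrm{Law}\Big(\tilde\alpha^{(\ell,p_a)}_{i_a}(x_a)\Big)_{a=1,\dots,m}=\mathcal N(0,M)$$ holds, each of the successive inner limits existing as a probability law (for $\ell=1$ there is no limit and the law equals $\mathcal N(0,M)$). -/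

import Mathlib

open MeasureTheory ProbabilityTheory Filter Topology
open scoped NNReal Matrix

/-- The combinatorial data of a graph-based network: for each layer `ℓ` a set of positions `I ℓ`,
for each position `p` of layer `ℓ + 1` a finite set of parents in layer `ℓ`, and an equivalence
relation saying which connections `q → p` between layers `ℓ` and `ℓ + 1` share their weight matrix.
Two distinct connections into the same position are never shared. A network with finitely many
layers is obtained by only looking at its first layers. -/
structure GraphArchitecture where
  /-- positions of layer `ℓ` -/
  I : ℕ → Type*
  /-- parents `P(p)` of a position -/
  parents : ∀ ℓ, I (ℓ + 1) → Finset (I ℓ)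
  /-- sharing of the connections `q → p`, encoded as pairs `⟨p, q⟩` with `q ∈ P(p)` -/
  share : ∀ ℓ, Setoid (Σ p : I (ℓ + 1), {q : I ℓ // q ∈ parents ℓ p})
  share_same_child : ∀ (ℓ : ℕ) (p : I (ℓ + 1)) (q q' : {q : I ℓ // q ∈ parents ℓ p}),
    (share ℓ).r ⟨p, q⟩ ⟨p, q'⟩ → q = q'

namespace GraphArchitecture

/-- Connections `q → p` from layer `ℓ` to layer `ℓ + 1`. -/
abbrev Connection (G : GraphArchitecture) (ℓ : ℕ) : Type _ :=
  Σ p : G.I (ℓ + 1), {q : G.I ℓ // q ∈ G.parents ℓ p}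

open scoped Classical in
/-- The sharing indicator `χ(q → p, q' → p')`. -/
noncomputable def chi (G : GraphArchitecture) (ℓ : ℕ) (a b : G.Connection ℓ) : ℝ :=
  if (G.share ℓ).r a b then 1 else 0

/-- Names of the free parameters: the bias entries `b^(ℓ)_i`, and one matrix with entries `(i, j)`
for every class of shared connections. All channels are numbered by `ℕ`; the network with widths
`n` uses only the entries with `i < n (ℓ + 1)` and `j < n ℓ`. -/
inductive Param (G : GraphArchitecture)
  | bias (ℓ i : ℕ) : Param G
  | weight (ℓ : ℕ) (c : Quotient (G.share ℓ)) (i j : ℕ) : Param G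

/-- The entry `(i, j)` of the weight matrix `W^(ℓ, q → p)`, where `i` is the channel in layer
`ℓ + 1` and `j` the channel in layer `ℓ`; shared connections read the same parameters. -/
def W (G : GraphArchitecture) (θ : G.Param → ℝ) (ℓ : ℕ) (p : G.I (ℓ + 1))
    (q : {q : G.I ℓ // q ∈ G.parents ℓ p}) (i j : ℕ) : ℝ :=
  θ (.weight ℓ (Quotient.mk (G.share ℓ) ⟨p, q⟩) i j)

/-- Inputs: elements of `(ℝ^{n₀})^{I₀}`. -/
abbrev Input (G : GraphArchitecture) (n₀ : ℕ) : Type _ := G.I 0 → Fin n₀ → ℝ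

/-- `G.preact n₀ β σ n θ x ℓ p i` is the preactivation of layer `ℓ + 1` at position `p` and
channel `i`, for the input `x`, the parameters `θ`, input width `n₀` and widths `n 1, n 2, …` of
the layers `1, 2, …` (the value `n 0` is not used). It is defined for every `i : ℕ`; the channels
of layer `ℓ + 1` are those with `i < n (ℓ + 1)`. -/
noncomputable def preact (G : GraphArchitecture) (n₀ : ℕ) (β : ℝ) (σ : ℝ → ℝ) (n : ℕ → ℕ)
    (θ : G.Param → ℝ) (x : G.Input n₀) : (ℓ : ℕ) → G.I (ℓ + 1) → ℕ → ℝ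
  | 0, p, i =>
      β * θ (.bias 0 i)
        + √(1 - β ^ 2) / √(((G.parents 0 p).card : ℝ) * n₀)
          * ∑ q ∈ (G.parents 0 p).attach, ∑ j : Fin n₀, G.W θ 0 p q i j * x q j
  | ℓ + 1, p, i =>
      β * θ (.bias (ℓ + 1) i)
        + √(1 - β ^ 2) / √(((G.parents (ℓ + 1) p).card : ℝ) * n (ℓ + 1))
          * ∑ q ∈ (G.parents (ℓ + 1) p).attach, ∑ j ∈ Finset.range (n (ℓ + 1)),
              G.W θ (ℓ + 1) p q i j * σ (preact G n₀ β σ n θ x ℓ q j)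

/-- `E[g(y₀) g(y₁)]` for a centered Gaussian pair with covariance `!![a, b; c, d]`. -/
noncomputable def gaussianPairExpectation (g : ℝ → ℝ) (S : Matrix (Fin 2) (Fin 2) ℝ) : ℝ :=
  ∫ y, g (y 0) * g (y 1) ∂(multivariateGaussian 0 S)

/-- The limiting covariance: `G.kernelSigma n₀ β σ ℓ p p' x y` is `Σ^(ℓ+1, pp')(x, y)`. -/
noncomputable def kernelSigma (G : GraphArchitecture) (n₀ : ℕ) (β : ℝ) (σ : ℝ → ℝ) :
    (ℓ : ℕ) → G.I (ℓ + 1) → G.I (ℓ + 1) → G.Input n₀ → G.Input n₀ → ℝ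
  | 0, p, p', x, y =>
      β ^ 2 + (1 - β ^ 2) / (√(((G.parents 0 p).card : ℝ) * (G.parents 0 p').card) * n₀)
        * ∑ q ∈ (G.parents 0 p).attach, ∑ q' ∈ (G.parents 0 p').attach,
            G.chi 0 ⟨p, q⟩ ⟨p', q'⟩ * (x q ⬝ᵥ y q')
  | ℓ + 1, p, p', x, y =>
      β ^ 2 + (1 - β ^ 2) / √(((G.parents (ℓ + 1) p).card : ℝ) * (G.parents (ℓ + 1) p').card)
        * ∑ q ∈ (G.parents (ℓ + 1) p).attach, ∑ q' ∈ (G.parents (ℓ + 1) p').attach,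
            G.chi (ℓ + 1) ⟨p, q⟩ ⟨p', q'⟩
              * gaussianPairExpectation σ
                  !![kernelSigma G n₀ β σ ℓ q q x x, kernelSigma G n₀ β σ ℓ q q' x y;
                     kernelSigma G n₀ β σ ℓ q' q y x, kernelSigma G n₀ β σ ℓ q' q' y y]

section Law

variable {Ω : Type*} [MeasurableSpace Ω] {P : Measure Ω}

lemma aemeasurable_preact (G : GraphArchitecture) (n₀ : ℕ) (β : ℝ) {σ : ℝ → ℝ}
    (hσ : Measurable σ) (n : ℕ → ℕ) {θ : G.Param → Ω → ℝ} (hθ : ∀ a, AEMeasurable (θ a) P)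
    (x : G.Input n₀) (ℓ : ℕ) (p : G.I (ℓ + 1)) (i : ℕ) :
    AEMeasurable (fun ω => G.preact n₀ β σ n (fun a => θ a ω) x ℓ p i) P := by
  induction ℓ generalizing i with
  | zero =>
    simp only [preact, W]
    refine ((hθ _).const_mul _).add (AEMeasurable.const_mul ?_ _)
    exact Finset.aemeasurable_fun_sum _ fun q _ => Finset.aemeasurable_fun_sum _ fun j _ =>
      (hθ _).mul_const _
  | succ ℓ ih =>
    simp only [preact, W]
    refine ((hθ _).const_mul _).add (AEMeasurable.const_mul ?_ _)
    exact Finset.aemeasurable_fun_sum _ fun q _ => Finset.aemeasurable_fun_sum _ fun j _ =>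
      (hθ _).mul (hσ.comp_aemeasurable (ih _ _))

/-- The joint law of the preactivations of layer `ℓ + 1` at finitely many channels `i a`,
positions `p a` and inputs `x a`, for random parameters `θ` and widths `n`. -/
noncomputable def preactLaw (G : GraphArchitecture) (n₀ : ℕ) (β : ℝ) {σ : ℝ → ℝ}
    (hσ : Measurable σ) [IsProbabilityMeasure P] {θ : G.Param → Ω → ℝ}
    (hθ : ∀ a, AEMeasurable (θ a) P) (ℓ : ℕ) {m : ℕ} (i : Fin m → ℕ) (p : Fin m → G.I (ℓ + 1))
    (x : Fin m → G.Input n₀) (n : ℕ → ℕ) : ProbabilityMeasure (EuclideanSpace ℝ (Fin m)) :=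
  ⟨P.map (fun ω => WithLp.toLp 2 fun a => G.preact n₀ β σ n (fun b => θ b ω) (x a) ℓ (p a) (i a)),
    Measure.isProbabilityMeasure_map <|
      (WithLp.measurable_toLp 2 (Fin m → ℝ)).comp_aemeasurable <|
        aemeasurable_pi_lambda _ fun a =>
          G.aemeasurable_preact n₀ β hσ n hθ (x a) ℓ (p a) (i a)⟩

end Law

/-- The matrix `Σ^(ℓ+1, p_a p_b)(x_a, x_b) δ_{i_a i_b}`. -/
noncomputable def covMatrix (G : GraphArchitecture) (n₀ : ℕ) (β : ℝ) (σ : ℝ → ℝ) (ℓ : ℕ) {m : ℕ}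
    (i : Fin m → ℕ) (p : Fin m → G.I (ℓ + 1)) (x : Fin m → G.Input n₀) :
    Matrix (Fin m) (Fin m) ℝ :=
  Matrix.of fun a b => G.kernelSigma n₀ β σ ℓ (p a) (p b) (x a) (x b) * (if i a = i b then 1 else 0)

end GraphArchitecture

/-- `HasSequentialLimit k F H` says that `H n = lim_{n_k → ∞} ⋯ lim_{n_1 → ∞} F n`: the widths go
to infinity one after the other, `n 1` first and `n k` last, and each of the successive limits
exists (for all values of the other widths). -/
def HasSequentialLimit {X : Type*} [TopologicalSpace X] :
    ℕ → ((ℕ → ℕ) → X) → ((ℕ → ℕ) → X) → Prop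
  | 0, F, H => ∀ n, F n = H n
  | k + 1, F, H => ∃ K : (ℕ → ℕ) → X, HasSequentialLimit k F K ∧
      ∀ n, Tendsto (fun w => K (Function.update n (k + 1) w)) atTop (𝓝 (H n))

/-- The centered Gaussian law on `ℝ^m` with covariance matrix `S`. -/
noncomputable def centeredGaussian {m : ℕ} (S : Matrix (Fin m) (Fin m) ℝ) :
    ProbabilityMeasure (EuclideanSpace ℝ (Fin m)) :=
  ⟨multivariateGaussian 0 S, inferInstance⟩

/-! Given the preactivations φ of one layer, the next layer is linear in fresh Gaussian parameters,
hence centered Gaussian with a covariance `condCov` that depends on φ. If φ is the limiting Gaussian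
field, its channels are i.i.d.; by the strong law `condCov` tends almost surely to the deterministic
`limCov`, and dominated convergence over φ leaves the Gaussian law with covariance `limCov`
(`cylinderConv_gp`).

Each such limit must still pass through later layers of finite width. As σ is only measurable, weak
convergence need not survive its application. The induction therefore carries setwise convergence on
events in finitely many coordinates (`CylinderConv`), which measurable maps preserve
(`cylinderConv_nextLaw`). The price is that Gaussian laws must converge setwise along with their
covariances, which fails in general at a singular limit. Here it holds: `limCov` is the mean of the
positive semidefinite covariance contributed by a single channel, so a vector in its kernel is
almost surely killed by every contribution (`condCov_mul_eq_zero`). Off the kernel the densities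
converge (`Matrix.PosSemidef.exists_tendsto_multivariateGaussian`).

The successive limits are explicit: `partialLimitLaw` with index `k` has layers `1, …, k` infinitely
wide, and raising `k` by one is one more limit. Parent sets being finite, only finitely many
positions of each layer matter. -/

open scoped ENNReal

/-! ### Centered Gaussian measures: densities, linear images, setwise convergence. -/

section
variable {T : Type*} [Fintype T]

/-- Both sides have the same characteristic function. The value of the normalizing constant is never
needed. -/
lemma stdGaussian_eq_withDensity :
    ∃ c : ℝ, stdGaussian (EuclideanSpace ℝ T) =
      volume.withDensity fun z => ENNReal.ofReal (c * Real.exp (-(1 / 2) * ‖z‖ ^ 2)) := by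
  have hI : ∀ t : EuclideanSpace ℝ T,
      ∫ z : EuclideanSpace ℝ T, Complex.exp (-(1 / 2 : ℂ) * ‖z‖ ^ 2 + Complex.I * inner ℝ t z) =
        (Real.pi / (1 / 2 : ℂ)) ^ (Module.finrank ℝ (EuclideanSpace ℝ T) / 2 : ℂ) *
          Complex.exp (-‖t‖ ^ 2 / 2) := by
    intro t
    rw [GaussianFourier.integral_cexp_neg_mul_sq_norm_add (by norm_num)]
    congr 2
    simp
    ring
  have hint : Integrable fun z : EuclideanSpace ℝ T => Real.exp (-(1 / 2) * ‖z‖ ^ 2) := by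
    have := (GaussianFourier.integrable_cexp_neg_mul_sq_norm_add
      (V := EuclideanSpace ℝ T) (b := 1 / 2) (by norm_num) 0 0).re
    refine this.congr (Eventually.of_forall fun z => ?_)
    simp only [zero_mul, add_zero]
    rw [show (-(1 / 2 : ℂ) * ‖z‖ ^ 2) = ((-(1 / 2) * ‖z‖ ^ 2 : ℝ) : ℂ) by push_cast; ring,
      ← Complex.ofReal_exp]
    exact Complex.ofReal_re _
  set k : ℝ := ∫ z : EuclideanSpace ℝ T, Real.exp (-(1 / 2) * ‖z‖ ^ 2) with hk
  -- The Fourier identity at `t = 0` identifies its complex prefactor with the total mass `k`.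
  have hkC : (Real.pi / (1 / 2 : ℂ)) ^ (Module.finrank ℝ (EuclideanSpace ℝ T) / 2 : ℂ) = (k : ℂ) := by
    have := hI 0
    simp only [inner_zero_left, Complex.ofReal_zero, mul_zero, add_zero, norm_zero] at this
    rw [hk, ← integral_complex_ofReal]
    simp only [Complex.ofReal_exp]
    push_cast
    rw [this]
    simp
  have hkpos : 0 < k := integral_exp_pos hint
  refine ⟨k⁻¹, ?_⟩
  have hnn : ∀ z : EuclideanSpace ℝ T, 0 ≤ k⁻¹ * Real.exp (-(1 / 2) * ‖z‖ ^ 2) := fun z => by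
    positivity
  have : IsFiniteMeasure (volume.withDensity fun z : EuclideanSpace ℝ T =>
      ENNReal.ofReal (k⁻¹ * Real.exp (-(1 / 2) * ‖z‖ ^ 2))) :=
    isFiniteMeasure_withDensity_ofReal (hint.const_mul _).2
  refine Measure.ext_of_charFun (funext fun t => ?_)
  rw [charFun_stdGaussian, charFun_apply, integral_withDensity_eq_integral_toReal_smul
    (by fun_prop) (by simp)]
  simp only [ENNReal.toReal_ofReal (hnn _)]
  have : ∀ z : EuclideanSpace ℝ T, (k⁻¹ * Real.exp (-(1 / 2) * ‖z‖ ^ 2)) •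
      Complex.exp (inner ℝ z t * Complex.I) =
      (k : ℂ)⁻¹ * Complex.exp (-(1 / 2 : ℂ) * ‖z‖ ^ 2 + Complex.I * inner ℝ t z) := by
    intro z
    rw [Complex.exp_add, real_inner_comm, mul_comm Complex.I]
    simp [Complex.real_smul, mul_assoc]
  simp only [this]
  rw [integral_const_mul, hI, hkC, inv_mul_cancel_left₀ (by exact_mod_cast hkpos.ne')]

variable [DecidableEq T]

lemma eq_multivariateGaussian_of_charFun {S : Matrix T T ℝ} (hS : S.PosSemidef)
    {μ : Measure (EuclideanSpace ℝ T)} [IsFiniteMeasure μ]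
    (h : ∀ t : EuclideanSpace ℝ T, charFun μ t = Complex.exp (-((t ⬝ᵥ S *ᵥ t : ℝ) : ℂ) / 2)) :
    μ = multivariateGaussian 0 S := by
  refine Measure.ext_of_charFun (funext fun t => ?_)
  rw [h, charFun_multivariateGaussian hS]
  simp [neg_div]

lemma multivariateGaussian_map_mulVec {T' : Type*} [Fintype T'] [DecidableEq T']
    {S : Matrix T T ℝ} (hS : S.PosSemidef) (M : Matrix T' T ℝ) :
    (multivariateGaussian 0 S).map (fun z => WithLp.toLp 2 (M *ᵥ z.ofLp)) =
      multivariateGaussian 0 (M * S * Mᵀ) := by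
  have hm : Measurable fun z : EuclideanSpace ℝ T => WithLp.toLp 2 (M *ᵥ z.ofLp) := by fun_prop
  have : IsProbabilityMeasure
      ((multivariateGaussian 0 S).map (fun z => WithLp.toLp 2 (M *ᵥ z.ofLp))) :=
    Measure.isProbabilityMeasure_map hm.aemeasurable
  refine eq_multivariateGaussian_of_charFun ?_ fun t => ?_
  · simpa using hS.mul_mul_conjTranspose_same M
  have : charFun ((multivariateGaussian 0 S).map (fun z => WithLp.toLp 2 (M *ᵥ z.ofLp))) t =
      charFun (multivariateGaussian 0 S) (WithLp.toLp 2 (Mᵀ *ᵥ t.ofLp)) := by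
    rw [charFun_apply, charFun_apply, integral_map hm.aemeasurable (by fun_prop)]
    congr! 5 with z
    simp [EuclideanSpace.inner_eq_star_dotProduct, Matrix.dotProduct_mulVec,
      ← Matrix.mulVec_transpose]
  rw [this, charFun_multivariateGaussian hS]
  simp [neg_div, Matrix.dotProduct_mulVec, Matrix.mulVec_transpose, Matrix.vecMul_vecMul, Matrix.mul_assoc, ← Matrix.mulVec_mulVec]

/-- A symmetric square root `s` of a positive semidefinite matrix, a pseudo-inverse `J` of `s` and
the projection `Q` onto the kernel. -/
lemma Matrix.PosSemidef.exists_sqrt_pinv {S : Matrix T T ℝ} (hS : S.PosSemidef) :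
    ∃ s J Q : Matrix T T ℝ, sᵀ = s ∧ Jᵀ = J ∧ s * s = S ∧ s * J = 1 - Q ∧ J * s = 1 - Q ∧
      s * Q = 0 ∧ Qᵀ = Q ∧ Q * Q = Q := by
  set U : Matrix T T ℝ := (hS.isHermitian.eigenvectorUnitary : Matrix T T ℝ) with hU
  have hU1 : U * Uᵀ = 1 := by
    simpa [star_eq_conjTranspose] using
      (Unitary.mul_star_self_of_mem hS.isHermitian.eigenvectorUnitary.2)
  have hU2 : Uᵀ * U = 1 := by
    simpa [star_eq_conjTranspose] using
      (Unitary.star_mul_self_of_mem hS.isHermitian.eigenvectorUnitary.2)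
  set l := hS.isHermitian.eigenvalues with hl
  have hl0 : ∀ i, 0 ≤ l i := hS.eigenvalues_nonneg
  have hSU : S = U * diagonal l * Uᵀ := by
    have := hS.isHermitian.spectral_theorem
    rw [Unitary.conjStarAlgAut_apply] at this
    simpa [star_eq_conjTranspose, Function.comp_def] using this
  have hmul : ∀ d e : T → ℝ, (U * diagonal d * Uᵀ) * (U * diagonal e * Uᵀ) =
      U * diagonal (fun i => d i * e i) * Uᵀ := by
    intro d e
    calc _ = U * diagonal d * (Uᵀ * U) * diagonal e * Uᵀ := by simp only [Matrix.mul_assoc]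
      _ = _ := by rw [hU2, Matrix.mul_one, Matrix.mul_assoc U, diagonal_mul_diagonal]
  have htr : ∀ d : T → ℝ, (U * diagonal d * Uᵀ)ᵀ = U * diagonal d * Uᵀ := by
    intro d; simp [Matrix.transpose_mul, Matrix.mul_assoc]
  have hone : U * diagonal (fun _ => (1 : ℝ)) * Uᵀ = 1 := by
    rw [diagonal_one, Matrix.mul_one, hU1]
  have hsub : ∀ d e : T → ℝ, U * diagonal d * Uᵀ - U * diagonal e * Uᵀ =
      U * diagonal (fun i => d i - e i) * Uᵀ := by
    intro d e
    rw [← Matrix.sub_mul, ← Matrix.mul_sub, diagonal_sub]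
  have hJ : ∀ i, (√(l i)) * (√(l i))⁻¹ = 1 - if l i = 0 then 1 else 0 := by
    intro i
    split_ifs with h
    · simp [h]
    · rw [mul_inv_cancel₀, sub_zero]
      exact (Real.sqrt_pos.2 ((hl0 i).lt_of_ne' h)).ne'
  refine ⟨U * diagonal (fun i => √(l i)) * Uᵀ, U * diagonal (fun i => (√(l i))⁻¹) * Uᵀ,
    U * diagonal (fun i => if l i = 0 then 1 else 0) * Uᵀ, htr _, htr _, ?_, ?_, ?_, ?_, htr _, ?_⟩
  · rw [hmul, hSU]
    simp only [Real.mul_self_sqrt (hl0 _)]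
  · rw [hmul, ← hone, hsub]
    simp only [hJ]
  · rw [hmul, ← hone, hsub]
    simp only [mul_comm _ (√(l _)), hJ]
  · rw [hmul]
    have : ∀ i, √(l i) * (if l i = 0 then 1 else 0) = 0 := fun i => by split_ifs with h <;> simp [h]
    simp [this]
  · rw [hmul]
    simp only [mul_ite, mul_one, mul_zero]
    congr 3
    funext i
    split_ifs <;> rfl

/-- Nondegenerate centered Gaussian laws have the usual density. -/
lemma multivariateGaussian_eq_lintegral :
    ∃ c : ℝ, ∀ D : Matrix T T ℝ, D.PosDef → ∀ A : Set (EuclideanSpace ℝ T), MeasurableSet A →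
      multivariateGaussian 0 D A = ∫⁻ y in A, ENNReal.ofReal ((√D.det)⁻¹) *
        ENNReal.ofReal (c * Real.exp (-(1 / 2) * (y ⬝ᵥ D⁻¹ *ᵥ y))) := by
  obtain ⟨c, hc⟩ := stdGaussian_eq_withDensity (T := T)
  refine ⟨c, fun D hD A hA => ?_⟩
  -- N(0, D) is the image of the standard Gaussian under `s`; the density follows by a linear change
  -- of variables with |det s| = √det D.
  obtain ⟨s, hss⟩ : ∃ s : Matrix T T ℝ, D = s * sᵀ := by
    obtain ⟨s, J, Q, hs, -, h, -⟩ := hD.posSemidef.exists_sqrt_pinv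
    exact ⟨s, by rw [hs, h]⟩
  have hdet : s.det * s.det = D.det := by rw [hss, Matrix.det_mul, Matrix.det_transpose]
  have hDpos := hD.det_pos
  have hs0 : s.det ≠ 0 := fun h => by simp [h] at hdet; linarith
  have hsdet : |s.det| = √D.det := by rw [← hdet, Real.sqrt_mul_self_eq_abs]
  set L := Matrix.toEuclideanLin s with hL
  have hLdet : LinearMap.det L = s.det := by
    rw [hL, Matrix.toEuclideanLin, Matrix.toLpLin_eq_toLin, LinearMap.det_toLin]
  have hinv : ∀ z : EuclideanSpace ℝ T, ‖z‖ ^ 2 = L z ⬝ᵥ D⁻¹ *ᵥ L z := by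
    intro z
    have : IsUnit s.det := hs0.isUnit
    rw [show (L z).ofLp = s *ᵥ z.ofLp from rfl, hss, Matrix.mul_inv_rev, ← Matrix.mulVec_mulVec,
      Matrix.mulVec_mulVec _ s⁻¹, Matrix.nonsing_inv_mul _ this, Matrix.one_mulVec,
      Matrix.dotProduct_mulVec, ← Matrix.transpose_nonsing_inv, Matrix.vecMul_transpose,
      Matrix.mulVec_mulVec, Matrix.nonsing_inv_mul _ this, Matrix.one_mulVec,
      EuclideanSpace.real_norm_sq_eq]
    simp [dotProduct, sq]
  have hLm : Measurable L := L.continuous_of_finiteDimensional.measurable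
  have h1 : multivariateGaussian 0 D A = stdGaussian (EuclideanSpace ℝ T) (L ⁻¹' A) := by
    rw [hss, show s * sᵀ = s * 1 * sᵀ by simp, ← multivariateGaussian_map_mulVec Matrix.PosSemidef.one,
      multivariateGaussian_zero_one, Measure.map_apply (by fun_prop) hA]
    rfl
  rw [h1, hc, withDensity_apply _ (hLm hA)]
  have hmap := Measure.map_linearMap_addHaar_eq_smul_addHaar
    (volume : Measure (EuclideanSpace ℝ T)) (f := L) (by rwa [hLdet])
  rw [lintegral_const_mul _ (by fun_prop)]
  simp only [hinv]
  rw [← setLIntegral_map (μ := (volume : Measure (EuclideanSpace ℝ T))) (g := L) hA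
    (f := fun y : EuclideanSpace ℝ T => ENNReal.ofReal (c * Real.exp (-(1 / 2) * (y ⬝ᵥ D⁻¹ *ᵥ y)))) (by fun_prop) hLm,
    hmap, Measure.restrict_smul, lintegral_smul_measure, hLdet, abs_inv, hsdet, smul_eq_mul]

/-- Setwise convergence of nondegenerate Gaussian laws. -/
lemma tendsto_multivariateGaussian_one {D : ℕ → Matrix T T ℝ} (hD : ∀ n, (D n).PosSemidef)
    (hlim : Tendsto D atTop (𝓝 1)) {A : Set (EuclideanSpace ℝ T)} (hA : MeasurableSet A) :
    Tendsto (fun n => multivariateGaussian 0 (D n) A) atTop (𝓝 (multivariateGaussian 0 1 A)) := by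
  obtain ⟨c, hc⟩ := multivariateGaussian_eq_lintegral (T := T)
  have hdet : Tendsto (fun n => (D n).det) atTop (𝓝 1) := by
    simpa [Function.comp_def] using
      ((continuous_id.matrix_det (R := ℝ) (n := T)).tendsto 1).comp hlim
  have hpos : ∀ᶠ n in atTop, (D n).PosDef := by
    filter_upwards [hdet.eventually_ne one_ne_zero] with n hn
    exact (hD n).posDef_iff_isUnit.2 ((Matrix.isUnit_iff_isUnit_det _).2 hn.isUnit)
  have hinv : Tendsto (fun n => (D n)⁻¹) atTop (𝓝 1) := by
    have h1 : Tendsto (fun n => (D n).adjugate) atTop (𝓝 1) := by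
      simpa [Function.comp_def] using
        ((continuous_id.matrix_adjugate (R := ℝ) (n := T)).tendsto 1).comp hlim
    simpa [Matrix.inv_def] using (hdet.inv₀ one_ne_zero).smul h1
  -- Scheffé's argument: Fatou bounds the lower limit for every event. Applied to `A` and to its
  -- complement, with total mass one, it gives convergence.
  have key : ∀ B : Set (EuclideanSpace ℝ T), MeasurableSet B →
      multivariateGaussian 0 1 B ≤ liminf (fun n => multivariateGaussian 0 (D n) B) atTop := by
    intro B hB
    have hpt : ∀ y : EuclideanSpace ℝ T, Tendsto (fun n => ENNReal.ofReal ((√(D n).det)⁻¹) *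
        ENNReal.ofReal (c * Real.exp (-(1 / 2) * (y ⬝ᵥ (D n)⁻¹ *ᵥ y)))) atTop
        (𝓝 (ENNReal.ofReal ((√(1 : Matrix T T ℝ).det)⁻¹) *
        ENNReal.ofReal (c * Real.exp (-(1 / 2) * (y ⬝ᵥ (1 : Matrix T T ℝ)⁻¹ *ᵥ y))))) := by
      intro y
      refine ENNReal.Tendsto.mul ?_ (by simp) ?_ (by simp)
      · refine ENNReal.tendsto_ofReal ?_
        have := ((Real.continuous_sqrt.tendsto 1).comp hdet).inv₀ (by simp)
        simpa using this
      · refine ENNReal.tendsto_ofReal (Tendsto.const_mul _ ?_)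
        refine (Real.continuous_exp.tendsto _).comp (Tendsto.const_mul _ ?_)
        have hcont : Continuous fun M : Matrix T T ℝ => y.ofLp ⬝ᵥ M *ᵥ y.ofLp := by fun_prop
        simpa [Function.comp_def] using (hcont.tendsto 1).comp hinv
    rw [hc 1 Matrix.PosDef.one B hB]
    calc _ = ∫⁻ y in B, liminf (fun n => ENNReal.ofReal ((√(D n).det)⁻¹) *
          ENNReal.ofReal (c * Real.exp (-(1 / 2) * (y ⬝ᵥ (D n)⁻¹ *ᵥ y)))) atTop :=
        lintegral_congr fun y => (hpt y).liminf_eq.symm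
      _ ≤ _ := lintegral_liminf_le fun n => by fun_prop
      _ = _ := liminf_congr (hpos.mono fun n hn => (hc _ hn B hB).symm)
  refine tendsto_measure_of_le_liminf_measure_of_limsup_measure_le subset_rfl subset_rfl (by simp)
    (key A hA) ?_
  exact limsup_measure_le_of_le_liminf_measure_compl hA (key _ hA.compl)

/-- Setwise convergence of centered Gaussian laws whose covariances vanish on the kernel of the
limit covariance; the columns of the matrix `Q` span this kernel. -/
lemma Matrix.PosSemidef.exists_tendsto_multivariateGaussian {S : Matrix T T ℝ}
    (hS : S.PosSemidef) :
    ∃ Q : Matrix T T ℝ, S * Q = 0 ∧ ∀ C : ℕ → Matrix T T ℝ, (∀ n, (C n).PosSemidef) →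
      Tendsto C atTop (𝓝 S) → (∀ᶠ n in atTop, C n * Q = 0) →
      ∀ A : Set (EuclideanSpace ℝ T), MeasurableSet A →
        Tendsto (fun n => multivariateGaussian 0 (C n) A) atTop
          (𝓝 (multivariateGaussian 0 S A)) := by
  obtain ⟨s, J, Q, hs, hJ, hss, hsJ, hJs, hsQ, hQ, hQQ⟩ := hS.exists_sqrt_pinv
  refine ⟨Q, by rw [← hss, Matrix.mul_assoc, hsQ, Matrix.mul_zero], fun C hC hlim hker A hA => ?_⟩
  -- Whitening by `J` turns the limit into the identity on the range of `S`; adding `Q` supplies the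
  -- missing identity on the kernel. Mapping back by `s` removes `Q` again and recovers `C n`,
  -- provided `C n` vanishes on the kernel.
  have hD : ∀ n, (J * C n * J + Q).PosSemidef := fun n => by
    refine Matrix.PosSemidef.add ?_ ?_
    · simpa [hJ] using (hC n).mul_mul_conjTranspose_same J
    · simpa [hQ, hQQ] using Matrix.posSemidef_self_mul_conjTranspose Q
  have hDlim : Tendsto (fun n => J * C n * J + Q) atTop (𝓝 1) := by
    have h1 : J * S * J + Q = 1 := by
      rw [← hss, ← Matrix.mul_assoc, hJs, Matrix.mul_assoc, hsJ, Matrix.mul_sub, Matrix.sub_mul _ _ Q]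
      simp [hQQ]
    rw [← h1]
    have hcont : Continuous fun M : Matrix T T ℝ => J * M * J + Q := by fun_prop
    exact (hcont.tendsto S).comp hlim
  have hm : Measurable fun z : EuclideanSpace ℝ T => WithLp.toLp 2 (s *ᵥ z.ofLp) := by fun_prop
  have h1 : ∀ᶠ n in atTop, multivariateGaussian 0 (C n) A =
      multivariateGaussian 0 (J * C n * J + Q) ((fun z => WithLp.toLp 2 (s *ᵥ z.ofLp)) ⁻¹' A) := by
    filter_upwards [hker] with n hCQ
    have hQC : Q * C n = 0 := by
      have := congrArg Matrix.transpose hCQ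
      simpa [Matrix.transpose_mul, hQ, show (C n)ᵀ = C n by simpa using (hC n).isHermitian.eq]
        using this
    rw [← Measure.map_apply hm hA, multivariateGaussian_map_mulVec (hD n), hs]
    congr 2
    rw [Matrix.mul_add, hsQ, add_zero]
    calc C n = (1 - Q) * C n * (1 - Q) := by
          rw [Matrix.sub_mul, hQC, Matrix.mul_sub]; simp [hCQ]
      _ = s * J * C n * (J * s) := by rw [hsJ, hJs]
      _ = _ := by simp only [Matrix.mul_assoc]
  have h2 : multivariateGaussian 0 S A =
      multivariateGaussian 0 1 ((fun z => WithLp.toLp 2 (s *ᵥ z.ofLp)) ⁻¹' A) := by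
    rw [← Measure.map_apply hm hA, multivariateGaussian_map_mulVec Matrix.PosSemidef.one, hs,
      Matrix.mul_one, hss]
  rw [h2]
  exact (tendsto_multivariateGaussian_one hD hDlim (hm hA)).congr' (h1.mono fun n hn => hn.symm)

/-- Finitely many finite linear combinations of i.i.d. standard Gaussian variables are jointly
centered Gaussian, and their covariance is the Gram matrix of the coefficients. -/
lemma infinitePi_map_linearCombination {K : Type*} (a : T → K →₀ ℝ) :
    (Measure.infinitePi fun _ : K => gaussianReal 0 1).map
        (fun z => WithLp.toLp 2 fun t => Finsupp.linearCombination ℝ z (a t)) =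
      multivariateGaussian 0 (Matrix.of fun t t' => Finsupp.linearCombination ℝ (a t') (a t)) ∧
    (Matrix.of fun t t' => Finsupp.linearCombination ℝ (a t') (a t)).PosSemidef := by
  classical
  set F : Finset K := Finset.univ.biUnion fun t => (a t).support with hF
  have hsub : ∀ t, (a t).support ⊆ F := fun t =>
    Finset.subset_biUnion_of_mem (fun t => (a t).support) (Finset.mem_univ t)
  have hsum : ∀ (z : K → ℝ) t, Finsupp.linearCombination ℝ z (a t) = ∑ k : F, a t k * z k := by
    intro z t
    rw [Finsupp.linearCombination_apply, Finsupp.sum_of_support_subset _ (hsub t) _ (by simp),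
      ← Finset.sum_coe_sort]
    simp
  set M : Matrix T F ℝ := Matrix.of fun t k => a t k with hM
  have hgram : (Matrix.of fun t t' => Finsupp.linearCombination ℝ (a t') (a t)) = M * Mᵀ := by
    ext t t'
    simp [hsum, hM, Matrix.mul_apply]
  rw [hgram]
  refine ⟨?_, by simpa using Matrix.posSemidef_self_mul_conjTranspose M⟩
  have h1 : (fun z : K → ℝ => WithLp.toLp 2 fun t => Finsupp.linearCombination ℝ z (a t)) =
      (fun z : EuclideanSpace ℝ F => WithLp.toLp 2 (M *ᵥ z.ofLp)) ∘ WithLp.toLp 2 ∘ F.restrict := by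
    ext z t
    simp [hsum, hM, Matrix.mulVec, dotProduct]
  rw [h1, ← Measure.map_map (by fun_prop) (by fun_prop), ← Measure.map_map (by fun_prop)
    (by fun_prop), Measure.infinitePi_map_restrict, map_pi_eq_stdGaussian,
    ← multivariateGaussian_zero_one, multivariateGaussian_map_mulVec Matrix.PosSemidef.one,
    Matrix.mul_one]
end

/-! ### One layer as a linear form in the parameters. -/

namespace GraphArchitecture

/-- Channels, positions and input indices of layer `L`. -/
abbrev Site (G : GraphArchitecture) (m L : ℕ) : Type _ := ℕ × G.I L × Fin m

/-- The law of i.i.d. standard Gaussian parameters. -/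
noncomputable def paramLaw (G : GraphArchitecture) : Measure (G.Param → ℝ) :=
  Measure.infinitePi fun _ => gaussianReal 0 1

instance (G : GraphArchitecture) : IsProbabilityMeasure G.paramLaw := by
  unfold paramLaw; infer_instance

section Affine

variable (G : GraphArchitecture) {m : ℕ} (β : ℝ) (L w : ℕ)

/-- The preactivations of layer `L + 1` computed from the features `h` of layer `L`, of which the
channels below `w` are used. -/
noncomputable def affine (θ : G.Param → ℝ) (h : G.Site m L → ℝ) : G.Site m (L + 1) → ℝ := fun s =>
  β * θ (.bias L s.1)
    + √(1 - β ^ 2) / √(((G.parents L s.2.1).card : ℝ) * w)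
      * ∑ q ∈ (G.parents L s.2.1).attach, ∑ j ∈ Finset.range w,
          G.W θ L s.2.1 q s.1 j * h (j, q, s.2.2)

/-- The covariance of `affine` over random parameters, for fixed features `h`. -/
noncomputable def condCov (h : G.Site m L → ℝ) (s t : G.Site m (L + 1)) : ℝ :=
  (β ^ 2 + (1 - β ^ 2) / √(((G.parents L s.2.1).card : ℝ) * (G.parents L t.2.1).card)
    * ∑ q ∈ (G.parents L s.2.1).attach, ∑ q' ∈ (G.parents L t.2.1).attach,
        G.chi L ⟨s.2.1, q⟩ ⟨t.2.1, q'⟩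
          * ((∑ j ∈ Finset.range w, h (j, q, s.2.2) * h (j, q', t.2.2)) / w))
    * if s.1 = t.1 then 1 else 0

/-- The coefficients of `affine` as a linear form in the parameters. -/
noncomputable def affineCoeff (h : G.Site m L → ℝ) (s : G.Site m (L + 1)) : G.Param →₀ ℝ :=
  Finsupp.single (.bias L s.1) β + ∑ q ∈ (G.parents L s.2.1).attach, ∑ j ∈ Finset.range w,
    Finsupp.single (.weight L (Quotient.mk (G.share L) ⟨s.2.1, q⟩) s.1 j)
      (√(1 - β ^ 2) / √(((G.parents L s.2.1).card : ℝ) * w) * h (j, q, s.2.2))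

variable {G β L w}

lemma linearCombination_affineCoeff (θ : G.Param → ℝ) (h : G.Site m L → ℝ)
    (s : G.Site m (L + 1)) :
    Finsupp.linearCombination ℝ θ (G.affineCoeff β L w h s) = G.affine β L w θ h s := by
  simp only [affineCoeff, affine, map_add, map_sum, Finsupp.linearCombination_single, smul_eq_mul,
    W, Finset.mul_sum]
  congr! 3 with q _ j _
  ring

lemma affineCoeff_bias (h : G.Site m L → ℝ) (s : G.Site m (L + 1)) (i : ℕ) :
    G.affineCoeff β L w h s (.bias L i) = if i = s.1 then β else 0 := by
  classical
  simp [affineCoeff, Finsupp.single_apply, eq_comm]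

/-- The weight is named by an arbitrary representative `c` of its class, so the coefficient collects
every connection into the position of `t` that is shared with `c`. -/
lemma affineCoeff_weight (h : G.Site m L → ℝ) (t : G.Site m (L + 1)) (c : G.Connection L)
    (i j : ℕ) (hj : j < w) :
    G.affineCoeff β L w h t (.weight L (Quotient.mk (G.share L) c) i j) =
      ∑ q ∈ (G.parents L t.2.1).attach, G.chi L c ⟨t.2.1, q⟩ * (if i = t.1 then 1 else 0) *
        (√(1 - β ^ 2) / √(((G.parents L t.2.1).card : ℝ) * w) * h (j, q, t.2.2)) := by
  classical
  simp only [affineCoeff, Finsupp.add_apply, Finsupp.finsetSum_apply, Finsupp.single_apply,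
    reduceCtorEq, if_false, zero_add, Param.weight.injEq, true_and]
  refine Finset.sum_congr rfl fun q _ => ?_
  rw [Finset.sum_eq_single j]
  · have : (Quotient.mk (G.share L) ⟨t.2.1, q⟩ = Quotient.mk (G.share L) c) ↔
        (G.share L).r c ⟨t.2.1, q⟩ := by
      rw [eq_comm, Quotient.eq]
    simp only [chi, eq_comm (a := t.1), and_true]
    split_ifs <;> simp_all
  · intro j' _ hj'
    simp [hj']
  · intro h
    simp [hj] at h

/-- The Gram entry of two coefficient vectors is obtained by evaluating the affine form of `s` at
the coefficients of `t` in place of the parameters. -/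
lemma linearCombination_affineCoeff_affineCoeff (hβ₀ : 0 ≤ β) (hβ₁ : β ≤ 1)
    (h : G.Site m L → ℝ) (s t : G.Site m (L + 1)) :
    Finsupp.linearCombination ℝ (G.affineCoeff β L w h t) (G.affineCoeff β L w h s) =
      G.condCov β L w h s t := by
  have hβ : 0 ≤ 1 - β ^ 2 := by nlinarith
  rw [linearCombination_affineCoeff, affine, condCov, affineCoeff_bias]
  simp only [W]
  have h1 : ∀ q ∈ (G.parents L s.2.1).attach, ∑ j ∈ Finset.range w,
      G.affineCoeff β L w h t (.weight L (Quotient.mk (G.share L) ⟨s.2.1, q⟩) s.1 j) *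
        h (j, q, s.2.2) = ∑ q' ∈ (G.parents L t.2.1).attach,
          G.chi L ⟨s.2.1, q⟩ ⟨t.2.1, q'⟩ * (if s.1 = t.1 then 1 else 0) *
            (√(1 - β ^ 2) / √(((G.parents L t.2.1).card : ℝ) * w)) *
            ∑ j ∈ Finset.range w, h (j, q, s.2.2) * h (j, q', t.2.2) := by
    intro q _
    simp only [Finset.mul_sum]
    rw [Finset.sum_comm]
    refine Finset.sum_congr rfl fun j hj => ?_
    rw [affineCoeff_weight _ _ _ _ _ (Finset.mem_range.1 hj), Finset.sum_mul]
    exact Finset.sum_congr rfl fun q' _ => by ring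
  rw [Finset.sum_congr rfl h1]
  have h2 : √(((G.parents L s.2.1).card : ℝ) * w) * √(((G.parents L t.2.1).card : ℝ) * w) =
      √(((G.parents L s.2.1).card : ℝ) * (G.parents L t.2.1).card) * w := by
    rw [← Real.sqrt_mul (by positivity), ← Real.sqrt_mul_self (Nat.cast_nonneg (α := ℝ) w),
      ← Real.sqrt_mul (by positivity), Real.sqrt_mul_self (Nat.cast_nonneg (α := ℝ) w)]
    congr 1
    ring
  have h3 : √(1 - β ^ 2) / √(((G.parents L s.2.1).card : ℝ) * w) *
      (√(1 - β ^ 2) / √(((G.parents L t.2.1).card : ℝ) * w)) =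
      (1 - β ^ 2) / √(((G.parents L s.2.1).card : ℝ) * (G.parents L t.2.1).card) / w := by
    rw [div_mul_div_comm, Real.mul_self_sqrt hβ, h2, div_div]
  rw [add_mul]
  congr 1
  · split_ifs <;> ring
  · simp only [Finset.mul_sum, Finset.sum_mul]
    refine Finset.sum_congr rfl fun q _ => Finset.sum_congr rfl fun q' _ => ?_
    rw [Finset.sum_div, Finset.mul_sum, Finset.mul_sum, Finset.sum_mul]
    refine Finset.sum_congr rfl fun j _ => ?_
    linear_combination G.chi L ⟨s.2.1, q⟩ ⟨t.2.1, q'⟩ * (if s.1 = t.1 then 1 else 0) *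
      (h (j, q, s.2.2) * h (j, q', t.2.2)) * h3

/-- For fixed features, the next preactivations are jointly centered Gaussian. -/
lemma paramLaw_map_affine (hβ₀ : 0 ≤ β) (hβ₁ : β ≤ 1) (h : G.Site m L → ℝ)
    {T : Type*} [Fintype T] [DecidableEq T] (s : T → G.Site m (L + 1)) :
    G.paramLaw.map (fun θ => WithLp.toLp 2 fun t => G.affine β L w θ h (s t)) =
        multivariateGaussian 0 (Matrix.of fun t t' => G.condCov β L w h (s t) (s t')) ∧
      (Matrix.of fun t t' => G.condCov β L w h (s t) (s t')).PosSemidef := by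
  have := infinitePi_map_linearCombination fun t => G.affineCoeff β L w h (s t)
  simpa only [linearCombination_affineCoeff, ← linearCombination_affineCoeff_affineCoeff hβ₀ hβ₁,
    paramLaw] using this

@[fun_prop]
lemma measurable_affine : Measurable fun z : (G.Site m L → ℝ) × (G.Param → ℝ) =>
    G.affine β L w z.2 z.1 := by
  refine measurable_pi_iff.2 fun s => ?_
  unfold affine W
  fun_prop

end Affine
end GraphArchitecture

/-! ### Setwise convergence on cylinders and its stability under a layer. -/

/-- Setwise convergence on the events that depend on finitely many coordinates in `D`. -/
def CylinderConv {ι : Type*} (D : Set ι) (μ : ℕ → Measure (ι → ℝ)) (ν : Measure (ι → ℝ)) : Prop :=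
  ∀ (R : Finset ι) (A : Set (ι → ℝ)), ↑R ⊆ D → MeasurableSet A →
    (∀ φ φ' : ι → ℝ, (∀ r ∈ R, φ r = φ' r) → φ ∈ A → φ' ∈ A) →
      Tendsto (fun n => μ n A) atTop (𝓝 (ν A))

lemma CylinderConv.const {ι : Type*} (D : Set ι) (μ : Measure (ι → ℝ)) :
    CylinderConv D (fun _ => μ) μ := fun _ _ _ _ _ => tendsto_const_nhds

/-- Cylinder convergence implies weak convergence of the finite-dimensional marginals. -/
lemma CylinderConv.tendsto_marginal {ι : Type*} {D : Set ι} {μ : ℕ → Measure (ι → ℝ)}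
    {ν : Measure (ι → ℝ)} (h : CylinderConv D μ ν) {m : ℕ} {s : Fin m → ι} (hs : ∀ a, s a ∈ D)
    {K : ℕ → ProbabilityMeasure (EuclideanSpace ℝ (Fin m))}
    {K' : ProbabilityMeasure (EuclideanSpace ℝ (Fin m))}
    (hK : ∀ n, (K n : Measure (EuclideanSpace ℝ (Fin m))) =
      (μ n).map fun φ => WithLp.toLp 2 fun a => φ (s a))
    (hK' : (K' : Measure (EuclideanSpace ℝ (Fin m))) =
      ν.map fun φ => WithLp.toLp 2 fun a => φ (s a)) :
    Tendsto K atTop (𝓝 K') := by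
  classical
  have hm : Measurable fun φ : ι → ℝ => (WithLp.toLp 2 fun a => φ (s a) :
      EuclideanSpace ℝ (Fin m)) := by fun_prop
  refine tendsto_of_forall_isOpen_le_liminf' fun O hO => ?_
  simp only [hK, hK', Measure.map_apply hm hO.measurableSet]
  refine (h (Finset.univ.image s) _ ?_ (hm hO.measurableSet) ?_).liminf_eq.ge
  · simpa [Set.range_subset_iff] using hs
  · intro φ φ' hφ hφA
    have : (fun a => φ (s a)) = fun a => φ' (s a) :=
      funext fun a => hφ _ (Finset.mem_image_of_mem s (Finset.mem_univ a))
    simpa only [Set.mem_preimage, this] using hφA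

/-- An event depending on the coordinates in `R` is an event of the marginal on `R`. -/
lemma exists_marginal_event {ι : Type*} {R : Finset ι} {A : Set (ι → ℝ)} (hA : MeasurableSet A)
    (hRA : ∀ φ φ' : ι → ℝ, (∀ r ∈ R, φ r = φ' r) → φ ∈ A → φ' ∈ A) :
    ∃ B : Set (EuclideanSpace ℝ R), MeasurableSet B ∧
      ∀ ψ : ι → ℝ, ψ ∈ A ↔ WithLp.toLp 2 (fun r : R => ψ r) ∈ B := by
  classical
  -- Extension by zero is a measurable section of the restriction to `R`, and `A` cannot tell a
  -- point from the extension of its restriction.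
  let e : EuclideanSpace ℝ R → ι → ℝ := fun y s => if h : s ∈ R then y ⟨s, h⟩ else 0
  have he : Measurable e := by
    refine measurable_pi_iff.2 fun s => ?_
    by_cases h : s ∈ R <;> simp only [e, h, dite_true, dite_false] <;> fun_prop
  refine ⟨e ⁻¹' A, he hA, fun ψ => ⟨hRA _ _ fun r hr => ?_, hRA _ _ fun r hr => ?_⟩⟩ <;>
    simp [e, hr]

namespace GraphArchitecture

variable {G : GraphArchitecture} {m : ℕ} {β : ℝ} {L w : ℕ}

lemma affine_congr (θ : G.Param → ℝ) {h h' : G.Site m L → ℝ} {s : G.Site m (L + 1)}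
    (hh : ∀ j < w, ∀ q ∈ G.parents L s.2.1, h (j, q, s.2.2) = h' (j, q, s.2.2)) :
    G.affine β L w θ h s = G.affine β L w θ h' s := by
  unfold affine
  congr 2
  refine Finset.sum_congr rfl fun q _ => Finset.sum_congr rfl fun j hj => ?_
  rw [hh j (Finset.mem_range.1 hj) q q.2]

variable (G β L w) in
/-- The law of the preactivations of layer `L + 2` when those of layer `L + 1` have law `μ`. -/
noncomputable def nextLaw (σ : ℝ → ℝ) (μ : Measure (G.Site m (L + 1) → ℝ)) :
    Measure (G.Site m (L + 2) → ℝ) :=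
  (μ.prod G.paramLaw).map fun z => G.affine β (L + 1) w z.2 fun s => σ (z.1 s)

variable {σ : ℝ → ℝ}

lemma measurable_affine_comp (hσ : Measurable σ) :
    Measurable fun z : (G.Site m (L + 1) → ℝ) × (G.Param → ℝ) =>
      G.affine β (L + 1) w z.2 fun s => σ (z.1 s) := by
  have : Measurable fun z : (G.Site m (L + 1) → ℝ) × (G.Param → ℝ) =>
      ((fun s => σ (z.1 s), z.2) : (G.Site m (L + 1) → ℝ) × (G.Param → ℝ)) := by fun_prop
  exact measurable_affine.comp this

lemma isProbabilityMeasure_nextLaw (hσ : Measurable σ) (μ : Measure (G.Site m (L + 1) → ℝ))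
    [IsProbabilityMeasure μ] : IsProbabilityMeasure (G.nextLaw β L w σ μ) :=
  Measure.isProbabilityMeasure_map (measurable_affine_comp hσ).aemeasurable

lemma nextLaw_apply (hσ : Measurable σ) (μ : Measure (G.Site m (L + 1) → ℝ))
    [IsProbabilityMeasure μ] {A : Set (G.Site m (L + 2) → ℝ)} (hA : MeasurableSet A) :
    G.nextLaw β L w σ μ A =
      ∫⁻ φ, G.paramLaw {θ | G.affine β (L + 1) w θ (fun s => σ (φ s)) ∈ A} ∂μ := by
  rw [nextLaw, Measure.map_apply (measurable_affine_comp hσ) hA,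
    Measure.prod_apply (measurable_affine_comp hσ hA)]
  rfl

lemma nextLaw_apply_symm (hσ : Measurable σ) (μ : Measure (G.Site m (L + 1) → ℝ))
    [IsProbabilityMeasure μ] {A : Set (G.Site m (L + 2) → ℝ)} (hA : MeasurableSet A) :
    G.nextLaw β L w σ μ A =
      ∫⁻ θ, μ {φ | G.affine β (L + 1) w θ (fun s => σ (φ s)) ∈ A} ∂G.paramLaw := by
  rw [nextLaw, Measure.map_apply (measurable_affine_comp hσ) hA,
    Measure.prod_apply_symm (measurable_affine_comp hσ hA)]
  rfl

/-- By Fubini the parameters can be fixed first. The event then concerns finitely many coordinates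
of the previous layer, so the hypothesis applies for each θ, and dominated convergence integrates
over θ. No continuity of σ enters. -/
lemma cylinderConv_nextLaw (hσ : Measurable σ) {Q : Set (G.I (L + 1))} {Q' : Set (G.I (L + 2))}
    (hQ : ∀ p ∈ Q', ↑(G.parents (L + 1) p) ⊆ Q) {μ : ℕ → Measure (G.Site m (L + 1) → ℝ)}
    {ν : Measure (G.Site m (L + 1) → ℝ)} [∀ n, IsProbabilityMeasure (μ n)]
    [IsProbabilityMeasure ν] (h : CylinderConv {s | s.2.1 ∈ Q} μ ν) :
    CylinderConv {s | s.2.1 ∈ Q'} (fun n => G.nextLaw β L w σ (μ n)) (G.nextLaw β L w σ ν) := by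
  classical
  intro R A hR hA hRA
  simp only [nextLaw_apply_symm hσ _ hA]
  have hmeas : Measurable fun z : (G.Site m (L + 1) → ℝ) × (G.Param → ℝ) =>
      G.affine β (L + 1) w z.2 fun s => σ (z.1 s) := measurable_affine_comp hσ
  refine tendsto_lintegral_of_dominated_convergence (fun _ => 1)
    (fun n => measurable_measure_prodMk_right (hmeas hA)) (fun n => ae_of_all _ fun θ => prob_le_one)
    (by simp) (ae_of_all _ fun θ => ?_)
  refine h (R.biUnion fun r => Finset.range w ×ˢ (G.parents (L + 1) r.2.1 ×ˢ {r.2.2})) _ ?_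
    ((hmeas.comp measurable_prodMk_right) hA) ?_
  · intro s hs
    simp only [Finset.coe_biUnion, Set.mem_iUnion, Finset.mem_coe, Finset.mem_product] at hs
    obtain ⟨r, hr, -, hs, -⟩ := hs
    exact hQ _ (hR hr) hs
  · intro φ φ' hφ hφA
    refine hRA _ _ (fun r hr => affine_congr θ fun j hj q hq => ?_) hφA
    refine congrArg σ (hφ _ (Finset.mem_biUnion.2 ⟨r, hr, ?_⟩))
    simp [hj, hq]

end GraphArchitecture

/-! ### The limiting Gaussian field and the law of large numbers over its channels. -/

/-- Finite-dimensional marginals of i.i.d. copies of a centered Gaussian vector. -/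
lemma infinitePi_multivariateGaussian_marginal {V T : Type*} [Fintype V] [DecidableEq V]
    [Fintype T] [DecidableEq T] {S : Matrix V V ℝ} (hS : S.PosSemidef) (c : T → ℕ) (v : T → V) :
    (Measure.infinitePi fun _ : ℕ => (multivariateGaussian 0 S).map WithLp.ofLp).map
        (fun y => WithLp.toLp 2 fun t => y (c t) (v t)) =
      multivariateGaussian 0 (Matrix.of fun t t' =>
        S (v t) (v t') * if c t = c t' then 1 else 0) ∧
    (Matrix.of fun t t' => S (v t) (v t') * if c t = c t' then 1 else 0).PosSemidef := by
  -- With `M` a symmetric square root of `S`, all copies become linear forms in one i.i.d. standard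
  -- array indexed by `ℕ × V`.
  obtain ⟨M, -, -, hM, -, hMM, -⟩ := hS.exists_sqrt_pinv
  have h1 : (multivariateGaussian 0 S).map WithLp.ofLp =
      (Measure.infinitePi fun _ : V => gaussianReal 0 1).map fun z => M *ᵥ z := by
    rw [Measure.infinitePi_eq_pi, ← hMM, show M * M = M * 1 * Mᵀ by simp [hM],
      ← multivariateGaussian_map_mulVec Matrix.PosSemidef.one, multivariateGaussian_zero_one,
      ← map_pi_eq_stdGaussian, Measure.map_map (by fun_prop) (by fun_prop),
      Measure.map_map (by fun_prop) (by fun_prop)]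
    rfl
  have h2 : (Measure.infinitePi fun _ : ℕ => (multivariateGaussian 0 S).map WithLp.ofLp) =
      (Measure.infinitePi fun _ : ℕ × V => gaussianReal 0 1).map
        fun z i => M *ᵥ fun u => z (i, u) := by
    rw [h1, ← Measure.infinitePi_map_pi (fun _ : ℕ => Measure.infinitePi fun _ : V => gaussianReal 0 1)
      (fun _ => by fun_prop), ← Measure.infinitePi_map_curry (ι := ℕ) (κ := V) (fun _ _ => gaussianReal 0 1),
      Measure.map_map (by fun_prop) (by fun_prop)]
    rfl
  let a : T → ℕ × V →₀ ℝ := fun t => ∑ u, Finsupp.single (c t, u) (M (v t) u)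
  have h3 := infinitePi_map_linearCombination a
  have h4 : (Matrix.of fun t t' : T =>
      Finsupp.linearCombination ℝ (a t') (a t)) =
      Matrix.of fun t t' => S (v t) (v t') * if c t = c t' then 1 else 0 := by
    ext t t'
    simp only [Matrix.of_apply, a]
    rw [← hMM, Matrix.mul_apply, Finset.sum_mul, map_sum]
    refine Finset.sum_congr rfl fun u _ => ?_
    rw [Finsupp.linearCombination_single, Finsupp.finsetSum_apply,
      Finset.sum_eq_single u (fun u' _ h => by simp [h]) (by simp),
      Finsupp.single_apply, ← Matrix.transpose_apply M (v t') u, hM]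
    simp [eq_comm (a := c t')]
  rw [h4] at h3
  rw [h2, Measure.map_map (by fun_prop) (by fun_prop), ← h3.1]
  refine ⟨?_, h3.2⟩
  congr 1
  ext z t
  simp [a, Matrix.mulVec, dotProduct]

namespace GraphArchitecture

section Field

variable (G : GraphArchitecture) {m n₀ : ℕ} (β : ℝ) (σ : ℝ → ℝ) (x : Fin m → G.Input n₀) (L : ℕ)

/-- The covariance of the limiting field of layer `L + 1`. -/
noncomputable def limCov (s t : G.Site m (L + 1)) : ℝ :=
  G.kernelSigma n₀ β σ L s.2.1 t.2.1 (x s.2.2) (x t.2.2) * if s.1 = t.1 then 1 else 0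

/-- The limiting covariance of layer `L + 1` is positive semidefinite on finite sets. -/
def LimCovPosSemidef : Prop :=
  ∀ R : Finset (G.Site m (L + 1)),
    (Matrix.of fun r r' : R => G.limCov β σ x L r.1 r'.1).PosSemidef

open scoped Classical in
/-- The limiting Gaussian field of layer `L + 1` at the positions in `Q`, extended by zero. -/
noncomputable def gp (Q : Finset (G.I (L + 1))) : Measure (G.Site m (L + 1) → ℝ) :=
  (Measure.infinitePi fun _ : ℕ => (multivariateGaussian 0 (Matrix.of fun v v' : Q × Fin m =>
    G.kernelSigma n₀ β σ L v.1 v'.1 (x v.2) (x v'.2))).map WithLp.ofLp).map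
      fun y s => if h : s.2.1 ∈ Q then y s.1 (⟨s.2.1, h⟩, s.2.2) else 0

variable {G β σ x L}

lemma LimCovPosSemidef.comp (h : G.LimCovPosSemidef β σ x L) {T : Type*} [Fintype T]
    (s : T → G.Site m (L + 1)) :
    (Matrix.of fun t t' => G.limCov β σ x L (s t) (s t')).PosSemidef := by
  classical
  exact (h (Finset.univ.image s)).submatrix
    fun t => ⟨s t, Finset.mem_image_of_mem s (Finset.mem_univ t)⟩

open scoped Classical in
lemma measurable_gp_extension {Q : Finset (G.I (L + 1))} :
    Measurable fun (y : ℕ → Q × Fin m → ℝ) (s : G.Site m (L + 1)) =>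
      if h : s.2.1 ∈ Q then y s.1 (⟨s.2.1, h⟩, s.2.2) else 0 := by
  refine measurable_pi_iff.2 fun s => ?_
  split_ifs <;> fun_prop

instance {T : Type*} [Fintype T] [DecidableEq T] {S : Matrix T T ℝ} :
    IsProbabilityMeasure ((multivariateGaussian 0 S).map WithLp.ofLp) :=
  Measure.isProbabilityMeasure_map (by fun_prop)

instance (Q : Finset (G.I (L + 1))) : IsProbabilityMeasure (G.gp β σ x L Q) :=
  Measure.isProbabilityMeasure_map measurable_gp_extension.aemeasurable

lemma gp_marginal (hPSD : G.LimCovPosSemidef β σ x L) {Q : Finset (G.I (L + 1))} {T : Type*}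
    [Fintype T] [DecidableEq T] {s : T → G.Site m (L + 1)} (hs : ∀ t, (s t).2.1 ∈ Q) :
    (G.gp β σ x L Q).map (fun φ => WithLp.toLp 2 fun t => φ (s t)) =
      multivariateGaussian 0 (Matrix.of fun t t' => G.limCov β σ x L (s t) (s t')) := by
  classical
  -- Within the single channel `0` the indicator in `limCov` is always one.
  have hS : (Matrix.of fun v v' : Q × Fin m =>
      G.kernelSigma n₀ β σ L v.1 v'.1 (x v.2) (x v'.2)).PosSemidef := by
    simpa [limCov] using hPSD.comp fun v : Q × Fin m => ((0, v.1, v.2) : G.Site m (L + 1))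
  rw [gp, Measure.map_map (by fun_prop) measurable_gp_extension]
  have := (infinitePi_multivariateGaussian_marginal hS (fun t => (s t).1)
    fun t => ((⟨(s t).2.1, hs t⟩, (s t).2.2) : Q × Fin m)).1
  simpa [Function.comp_def, hs, limCov] using this

lemma memLp_gp (hPSD : G.LimCovPosSemidef β σ x L)
    (hσ₂ : ∀ v : ℝ≥0, MemLp σ 2 (gaussianReal 0 v)) {Q : Finset (G.I (L + 1))}
    {s : G.Site m (L + 1)} (hs : s.2.1 ∈ Q) : MemLp (fun φ => σ (φ s)) 2 (G.gp β σ x L Q) := by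
  have h1 := gp_marginal hPSD (s := fun _ : Unit => s) fun _ => hs
  have h2 := (measurePreserving_eval_multivariateGaussian (μ := 0)
    (hPSD.comp fun _ : Unit => s) (i := ())).map_eq
  rw [← h1, Measure.map_map (by fun_prop) (by fun_prop)] at h2
  have h3 := hσ₂ (G.limCov β σ x L s s).toNNReal
  have h4 : (G.gp β σ x L Q).map (fun φ => φ s) =
      gaussianReal 0 (G.limCov β σ x L s s).toNNReal := h2
  rw [← h4] at h3
  exact h3.comp_of_map (measurable_pi_apply s).aemeasurable

lemma integral_gp (hPSD : G.LimCovPosSemidef β σ x L) (hσ : Measurable σ)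
    {Q : Finset (G.I (L + 1))} (j : ℕ) {p p' : G.I (L + 1)} (hp : p ∈ Q) (hp' : p' ∈ Q)
    (a a' : Fin m) :
    ∫ φ, σ (φ (j, p, a)) * σ (φ (j, p', a')) ∂(G.gp β σ x L Q) =
      gaussianPairExpectation σ
        !![G.kernelSigma n₀ β σ L p p (x a) (x a), G.kernelSigma n₀ β σ L p p' (x a) (x a');
           G.kernelSigma n₀ β σ L p' p (x a') (x a),
           G.kernelSigma n₀ β σ L p' p' (x a') (x a')] := by
  have h1 := gp_marginal hPSD (Q := Q)
    (s := ![((j, p, a) : G.Site m (L + 1)), (j, p', a')]) (by simp [Fin.forall_fin_two, hp, hp'])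
  have h2 : (Matrix.of fun t t' => G.limCov β σ x L
      (![((j, p, a) : G.Site m (L + 1)), (j, p', a')] t)
      (![((j, p, a) : G.Site m (L + 1)), (j, p', a')] t')) =
        !![G.kernelSigma n₀ β σ L p p (x a) (x a), G.kernelSigma n₀ β σ L p p' (x a) (x a');
           G.kernelSigma n₀ β σ L p' p (x a') (x a),
           G.kernelSigma n₀ β σ L p' p' (x a') (x a')] := by
    ext t t'
    fin_cases t <;> fin_cases t' <;> simp [limCov]
  rw [gaussianPairExpectation, ← h2, ← h1, integral_map (Measurable.aemeasurable (by fun_prop))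
    (by apply Measurable.aestronglyMeasurable; fun_prop)]
  simp

/-- The strong law over the i.i.d. channels. The products are integrable because σ is square
integrable under each Gaussian marginal. -/
lemma tendsto_average_gp (hPSD : G.LimCovPosSemidef β σ x L) (hσ : Measurable σ)
    (hσ₂ : ∀ v : ℝ≥0, MemLp σ 2 (gaussianReal 0 v)) {Q : Finset (G.I (L + 1))}
    {p p' : G.I (L + 1)} (hp : p ∈ Q) (hp' : p' ∈ Q) (a a' : Fin m) :
    ∀ᵐ φ ∂(G.gp β σ x L Q), Tendsto (fun w : ℕ =>
      (∑ j ∈ Finset.range w, σ (φ (j, p, a)) * σ (φ (j, p', a'))) / w) atTop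
      (𝓝 (gaussianPairExpectation σ
        !![G.kernelSigma n₀ β σ L p p (x a) (x a), G.kernelSigma n₀ β σ L p p' (x a) (x a');
           G.kernelSigma n₀ β σ L p' p (x a') (x a),
           G.kernelSigma n₀ β σ L p' p' (x a') (x a')])) := by
  classical
  have hint : Integrable (fun φ => σ (φ (0, p, a)) * σ (φ (0, p', a'))) (G.gp β σ x L Q) :=
    (memLp_gp hPSD hσ₂ (s := (0, p, a)) hp).integrable_mul
      (memLp_gp hPSD hσ₂ (s := (0, p', a')) hp')
  have hval := integral_gp hPSD hσ 0 hp hp' a a'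
  have hm := measurable_gp_extension (m := m) (Q := Q)
  rw [gp, integral_map hm.aemeasurable (by apply Measurable.aestronglyMeasurable; fun_prop)] at hval
  rw [gp, integrable_map_measure (by apply Measurable.aestronglyMeasurable; fun_prop)
    hm.aemeasurable] at hint
  rw [gp, ae_map_iff hm.aemeasurable (measurableSet_tendsto _ fun w => by fun_prop)]
  simp only [hp, hp', dite_true, Function.comp_def] at hval hint ⊢
  rw [← hval]
  set ν : Measure (Q × Fin m → ℝ) := (multivariateGaussian 0 (Matrix.of fun v v' : Q × Fin m =>
    G.kernelSigma n₀ β σ L v.1 v'.1 (x v.2) (x v'.2))).map WithLp.ofLp with hν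
  have : IsProbabilityMeasure ν := by rw [hν]; infer_instance
  let g : (Q × Fin m → ℝ) → ℝ := fun z => σ (z (⟨p, hp⟩, a)) * σ (z (⟨p', hp'⟩, a'))
  have hg : Measurable g := by fun_prop
  refine strong_law_ae_real (fun j (y : ℕ → Q × Fin m → ℝ) => g (y j)) hint ?_ fun j => ?_
  · intro i j hij
    exact (iIndepFun_infinitePi (P := fun _ : ℕ => ν) (X := fun _ => g) fun _ => hg).indepFun hij
  · refine ⟨(hg.comp (measurable_pi_apply j)).aemeasurable,
      (hg.comp (measurable_pi_apply 0)).aemeasurable, ?_⟩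
    have h1 : ∀ j, (Measure.infinitePi fun _ : ℕ => ν).map (fun y => g (y j)) = ν.map g := by
      intro j
      have := Measure.map_map (μ := Measure.infinitePi fun _ : ℕ => ν) hg (measurable_pi_apply j)
      rw [Measure.infinitePi_map_eval] at this
      exact this.symm
    rw [h1, h1]

end Field
end GraphArchitecture

/-! ### A layer of growing width on top of the limiting field. -/

namespace GraphArchitecture

variable {G : GraphArchitecture} {m n₀ : ℕ} {β : ℝ} {σ : ℝ → ℝ} {x : Fin m → G.Input n₀} {L : ℕ}

lemma measurable_affine_left {w : ℕ} (h : G.Site m L → ℝ) :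
    Measurable fun θ : G.Param → ℝ => G.affine β L w θ h := by
  refine measurable_pi_iff.2 fun s => ?_
  unfold affine W
  fun_prop

lemma tendsto_condCov {φ : G.Site m (L + 1) → ℝ} {s t : G.Site m (L + 2)}
    (h : ∀ p ∈ G.parents (L + 1) s.2.1, ∀ p' ∈ G.parents (L + 1) t.2.1,
      Tendsto (fun w : ℕ =>
        (∑ j ∈ Finset.range w, σ (φ (j, p, s.2.2)) * σ (φ (j, p', t.2.2))) / w) atTop
      (𝓝 (gaussianPairExpectation σ
        !![G.kernelSigma n₀ β σ L p p (x s.2.2) (x s.2.2),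
            G.kernelSigma n₀ β σ L p p' (x s.2.2) (x t.2.2);
           G.kernelSigma n₀ β σ L p' p (x t.2.2) (x s.2.2),
            G.kernelSigma n₀ β σ L p' p' (x t.2.2) (x t.2.2)]))) :
    Tendsto (fun w => G.condCov β (L + 1) w (fun r => σ (φ r)) s t) atTop
      (𝓝 (G.limCov β σ x (L + 1) s t)) := by
  simp only [condCov, limCov, kernelSigma]
  refine Tendsto.mul_const _ (Tendsto.const_add _ (Tendsto.const_mul _ ?_))
  refine tendsto_finsetSum _ fun q _ => tendsto_finsetSum _ fun q' _ => ?_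
  exact (h q q.2 q' q'.2).const_mul _

/-- Width `1` together with `(j, r.2)` isolates the contribution of channel `j`, whose mean is
already the limit covariance. -/
lemma integral_condCov_gp (hPSD : G.LimCovPosSemidef β σ x L) (hσ : Measurable σ)
    (hσ₂ : ∀ v : ℝ≥0, MemLp σ 2 (gaussianReal 0 v)) {Q : Finset (G.I (L + 1))} (j : ℕ)
    {s t : G.Site m (L + 2)} (hs : G.parents (L + 1) s.2.1 ⊆ Q)
    (ht : G.parents (L + 1) t.2.1 ⊆ Q) :
    Integrable (fun φ => G.condCov β (L + 1) 1 (fun r => σ (φ (j, r.2))) s t)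
        (G.gp β σ x L Q) ∧
      ∫ φ, G.condCov β (L + 1) 1 (fun r => σ (φ (j, r.2))) s t ∂(G.gp β σ x L Q) =
        G.limCov β σ x (L + 1) s t := by
  have hint : ∀ (q : {q // q ∈ G.parents (L + 1) s.2.1}) (q' : {q // q ∈ G.parents (L + 1) t.2.1}),
      Integrable (fun φ => σ (φ (j, q, s.2.2)) * σ (φ (j, q', t.2.2))) (G.gp β σ x L Q) :=
    fun q q' => (memLp_gp hPSD hσ₂ (s := (j, q, s.2.2)) (hs q.2)).integrable_mul
      (memLp_gp hPSD hσ₂ (s := (j, q', t.2.2)) (ht q'.2))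
  simp only [condCov, limCov, kernelSigma, Finset.sum_range_one, Nat.cast_one, div_one]
  have h1 : ∀ q ∈ (G.parents (L + 1) s.2.1).attach, Integrable (fun φ =>
      ∑ q' ∈ (G.parents (L + 1) t.2.1).attach, G.chi (L + 1) ⟨s.2.1, q⟩ ⟨t.2.1, q'⟩ *
        (σ (φ (j, q, s.2.2)) * σ (φ (j, q', t.2.2)))) (G.gp β σ x L Q) :=
    fun q _ => integrable_finsetSum _ fun q' _ => (hint q q').const_mul _
  have h2 := (integrable_finsetSum _ h1).const_mul ((1 - β ^ 2) /
    √(((G.parents (L + 1) s.2.1).card : ℝ) * (G.parents (L + 1) t.2.1).card))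
  refine ⟨((integrable_const _).add h2).mul_const _, ?_⟩
  rw [integral_mul_const, integral_add (integrable_const _) h2, integral_const,
    integral_const_mul, integral_finsetSum _ h1]
  congr 2
  · simp
  · congr 1
    refine Finset.sum_congr rfl fun q _ => ?_
    rw [integral_finsetSum _ fun q' _ => (hint q q').const_mul _]
    refine Finset.sum_congr rfl fun q' _ => ?_
    rw [integral_const_mul, integral_gp hPSD hσ j (hs q.2) (ht q'.2)]

lemma condCov_eq_average {w : ℕ} (hw : w ≠ 0) (h : G.Site m L → ℝ) (s t : G.Site m (L + 1)) :
    G.condCov β L w h s t =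
      (w : ℝ)⁻¹ * ∑ j ∈ Finset.range w, G.condCov β L 1 (fun r => h (j, r.2)) s t := by
  have hw' : (w : ℝ) ≠ 0 := Nat.cast_ne_zero.2 hw
  simp only [condCov, Finset.sum_range_one, Nat.cast_one, div_one]
  rw [← Finset.sum_mul, Finset.sum_add_distrib, ← Finset.mul_sum, ← mul_assoc, mul_add]
  congr 2
  · simp [hw']
  · rw [mul_left_comm]
    congr 1
    conv_rhs => rw [Finset.sum_comm, Finset.mul_sum]
    refine Finset.sum_congr rfl fun q _ => ?_
    conv_rhs => rw [Finset.sum_comm, Finset.mul_sum]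
    refine Finset.sum_congr rfl fun q' _ => ?_
    rw [← Finset.mul_sum]
    ring

/-- The conditional covariances almost surely vanish on the kernel of the limit covariance. -/
lemma condCov_mul_eq_zero (hβ₀ : 0 ≤ β) (hβ₁ : β ≤ 1) (hPSD : G.LimCovPosSemidef β σ x L)
    (hσ : Measurable σ) (hσ₂ : ∀ v : ℝ≥0, MemLp σ 2 (gaussianReal 0 v))
    {Q : Finset (G.I (L + 1))} {T : Type*} [Fintype T] {s : T → G.Site m (L + 2)}
    (hs : ∀ t, G.parents (L + 1) (s t).2.1 ⊆ Q) {M : Matrix T T ℝ}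
    (hM : (Matrix.of fun t t' => G.limCov β σ x (L + 1) (s t) (s t')) * M = 0) :
    ∀ᵐ φ ∂(G.gp β σ x L Q), ∀ w ≠ 0,
      (Matrix.of fun t t' => G.condCov β (L + 1) w (fun r => σ (φ r)) (s t) (s t')) * M = 0 := by
  classical
  let c : ℕ → (G.Site m (L + 1) → ℝ) → Matrix T T ℝ := fun j φ =>
    Matrix.of fun t t' => G.condCov β (L + 1) 1 (fun r => σ (φ (j, r.2))) (s t) (s t')
  have hc : ∀ j φ, (c j φ).PosSemidef := fun j φ => (paramLaw_map_affine hβ₀ hβ₁ _ s).2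
  have hexp : ∀ j φ e, M.col e ⬝ᵥ c j φ *ᵥ M.col e =
      ∑ t, ∑ t', M t e * (c j φ t t' * M t' e) := by
    intro j φ e
    simp [dotProduct, Matrix.mulVec, Finset.mul_sum]
  have hcol : ∀ j e, ∀ᵐ φ ∂(G.gp β σ x L Q), c j φ *ᵥ M.col e = 0 := by
    intro j e
    have hI : ∀ t t', Integrable (fun φ => c j φ t t') (G.gp β σ x L Q) ∧
        ∫ φ, c j φ t t' ∂(G.gp β σ x L Q) = G.limCov β σ x (L + 1) (s t) (s t') :=
      fun t t' => integral_condCov_gp hPSD hσ hσ₂ j (hs t) (hs t')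
    have hint : ∀ t ∈ Finset.univ, Integrable (fun φ => ∑ t', M t e * (c j φ t t' * M t' e))
        (G.gp β σ x L Q) := fun t _ =>
      integrable_finsetSum _ fun t' _ => (((hI t t').1.mul_const _).const_mul _)
    have h0 : ∫ φ, M.col e ⬝ᵥ c j φ *ᵥ M.col e ∂(G.gp β σ x L Q) = 0 := by
      simp only [hexp]
      rw [integral_finsetSum _ hint]
      refine Finset.sum_eq_zero fun t _ => ?_
      rw [integral_finsetSum _ fun t' _ => (((hI t t').1.mul_const _).const_mul _)]
      have : ∀ t', ∫ φ, M t e * (c j φ t t' * M t' e) ∂(G.gp β σ x L Q) =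
          M t e * (G.limCov β σ x (L + 1) (s t) (s t') * M t' e) := by
        intro t'
        rw [integral_const_mul, integral_mul_const, (hI t t').2]
      simp only [this, ← Finset.mul_sum]
      have := congrFun (congrFun hM t) e
      simp only [Matrix.mul_apply, Matrix.of_apply, Matrix.zero_apply] at this
      rw [this, mul_zero]
    rw [integral_eq_zero_iff_of_nonneg (fun φ => by
        simpa using (hc j φ).dotProduct_mulVec_nonneg (M.col e))
      (by simp only [hexp]; exact integrable_finsetSum _ hint)] at h0
    filter_upwards [h0] with φ hφ
    exact ((hc j φ).dotProduct_mulVec_zero_iff _).1 (by simpa using hφ)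
  filter_upwards [ae_all_iff.2 fun j => ae_all_iff.2 (hcol j)] with φ hφ w hw
  have : (Matrix.of fun t t' => G.condCov β (L + 1) w (fun r => σ (φ r)) (s t) (s t')) =
      (w : ℝ)⁻¹ • ∑ j ∈ Finset.range w, c j φ := by
    ext t t'
    simp only [Matrix.of_apply, condCov_eq_average hw, Matrix.smul_apply, smul_eq_mul,
      Matrix.sum_apply, c]
  rw [this, Matrix.smul_mul, Matrix.sum_mul, Finset.sum_eq_zero, smul_zero]
  intro j _
  ext t e
  exact congrFun (hφ j e) t

lemma tendsto_condCov_gp (hPSD : G.LimCovPosSemidef β σ x L) (hσ : Measurable σ)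
    (hσ₂ : ∀ v : ℝ≥0, MemLp σ 2 (gaussianReal 0 v)) {Q : Finset (G.I (L + 1))} {T : Type*}
    [Finite T] {s : T → G.Site m (L + 2)} (hs : ∀ t, G.parents (L + 1) (s t).2.1 ⊆ Q) :
    ∀ᵐ φ ∂(G.gp β σ x L Q), Tendsto (fun w => (Matrix.of fun t t' =>
        G.condCov β (L + 1) w (fun r => σ (φ r)) (s t) (s t') : Matrix T T ℝ)) atTop
      (𝓝 (Matrix.of fun t t' => G.limCov β σ x (L + 1) (s t) (s t'))) := by
  have h1 := fun (p p' : Q) (a a' : Fin m) => tendsto_average_gp hPSD hσ hσ₂ p.2 p'.2 a a'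
  simp only [← ae_all_iff] at h1
  filter_upwards [h1] with φ hφ
  refine tendsto_pi_nhds.2 fun t => tendsto_pi_nhds.2 fun t' => ?_
  exact tendsto_condCov fun p hp p' hp' => hφ ⟨p, hs t hp⟩ ⟨p', hs t' hp'⟩ _ _

/-- Almost sure convergence provides at least one φ along which `limCov` is a limit of the positive
semidefinite matrices `condCov`. -/
lemma LimCovPosSemidef.succ (hβ₀ : 0 ≤ β) (hβ₁ : β ≤ 1) (hPSD : G.LimCovPosSemidef β σ x L)
    (hσ : Measurable σ) (hσ₂ : ∀ v : ℝ≥0, MemLp σ 2 (gaussianReal 0 v)) :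
    G.LimCovPosSemidef β σ x (L + 1) := by
  classical
  intro R
  obtain ⟨φ, hφ⟩ := (tendsto_condCov_gp hPSD hσ hσ₂
    (Q := Finset.univ.biUnion fun r : R => G.parents (L + 1) r.1.2.1) (s := fun r : R => r.1)
    fun r => Finset.subset_biUnion_of_mem (fun r : R => G.parents (L + 1) r.1.2.1)
      (Finset.mem_univ r)).exists
  have hw := fun w => (paramLaw_map_affine (w := w) hβ₀ hβ₁ (fun r => σ (φ r))
    fun r : R => r.1).2
  refine Matrix.PosSemidef.of_dotProduct_mulVec_nonneg ?_ fun v => ?_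
  · refine tendsto_nhds_unique ?_ hφ
    have hcont : Continuous fun M : Matrix R R ℝ => Mᴴ := by fun_prop
    refine ((hcont.tendsto _).comp hφ).congr fun w => (hw w).isHermitian
  · have hcont : Continuous fun M : Matrix R R ℝ => star v ⬝ᵥ M *ᵥ v := by fun_prop
    exact ge_of_tendsto' ((hcont.tendsto _).comp hφ) fun w => (hw w).dotProduct_mulVec_nonneg v

/-- As the width tends to infinity, a layer fed with the limiting Gaussian field of the previous
layer converges setwise on cylinders to the limiting Gaussian field. -/
lemma cylinderConv_gp (hβ₀ : 0 ≤ β) (hβ₁ : β ≤ 1) (hPSD : G.LimCovPosSemidef β σ x L)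
    (hσ : Measurable σ) (hσ₂ : ∀ v : ℝ≥0, MemLp σ 2 (gaussianReal 0 v))
    {Q : Finset (G.I (L + 1))} {Q' : Finset (G.I (L + 2))}
    (hQ : ∀ p ∈ Q', G.parents (L + 1) p ⊆ Q) :
    CylinderConv {s | s.2.1 ∈ Q'} (fun w => G.nextLaw β L w σ (G.gp β σ x L Q))
      (G.gp β σ x (L + 1) Q') := by
  classical
  intro R A hR hA hRA
  have hPSD' := hPSD.succ hβ₀ hβ₁ hσ hσ₂
  obtain ⟨B, hB, hAB⟩ := exists_marginal_event hA hRA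
  have hlim : G.gp β σ x (L + 1) Q' A = multivariateGaussian 0
      (Matrix.of fun r r' : R => G.limCov β σ x (L + 1) r r') B := by
    rw [← gp_marginal hPSD' (Q := Q') (s := fun r : R => r.1) fun r => hR r.2,
      Measure.map_apply (by fun_prop) hB]
    congr 1
    ext ψ
    exact hAB ψ
  have hcond : ∀ w (φ : G.Site m (L + 1) → ℝ),
      G.paramLaw {θ | G.affine β (L + 1) w θ (fun s => σ (φ s)) ∈ A} = multivariateGaussian 0
        (Matrix.of fun r r' : R => G.condCov β (L + 1) w (fun s => σ (φ s)) r r') B := by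
    intro w φ
    have hm : Measurable fun θ : G.Param → ℝ => G.affine β (L + 1) w θ (fun s => σ (φ s)) :=
      measurable_affine_left _
    rw [← (paramLaw_map_affine hβ₀ hβ₁ (fun s => σ (φ s)) fun r : R => r.1).1,
      Measure.map_apply (by fun_prop) hB]
    congr 1
    ext θ
    exact hAB _
  obtain ⟨M, hM, hconv⟩ := (hPSD' R).exists_tendsto_multivariateGaussian
  have hpar : ∀ r : R, G.parents (L + 1) r.1.2.1 ⊆ Q := fun r => hQ _ (hR r.2)
  simp only [nextLaw_apply hσ _ hA]
  rw [show G.gp β σ x (L + 1) Q' A =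
    ∫⁻ _ : G.Site m (L + 1) → ℝ, G.gp β σ x (L + 1) Q' A ∂(G.gp β σ x L Q) by simp]
  refine tendsto_lintegral_of_dominated_convergence (fun _ => 1)
    (fun w => measurable_measure_prodMk_left (measurable_affine_comp hσ hA))
    (fun w => ae_of_all _ fun φ => prob_le_one) (by simp) ?_
  filter_upwards [tendsto_condCov_gp hPSD hσ hσ₂ hpar,
    condCov_mul_eq_zero hβ₀ hβ₁ hPSD hσ hσ₂ hpar hM] with φ h1 h2
  simp only [hcond, hlim]
  -- Width `0` is excluded: there `condCov` is not an average over channels and need not vanish on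
  -- the kernel.
  exact hconv _ (fun w => (paramLaw_map_affine hβ₀ hβ₁ _ _).2) h1
    ((eventually_ne_atTop 0).mono h2) _ hB

end GraphArchitecture

/-! ### The finite network as a chain of layers. -/

lemma hasSequentialLimit_of_tendsto {X : Type*} [TopologicalSpace X] (K : ℕ → (ℕ → ℕ) → X) (k : ℕ)
    (h : ∀ j < k, ∀ n, Tendsto (fun w => K j (Function.update n (j + 1) w)) atTop
      (𝓝 (K (j + 1) n))) : HasSequentialLimit k (K 0) (K k) := by
  induction k with
  | zero => exact fun _ => rfl
  | succ k ih => exact ⟨K k, ih fun j hj => h j (hj.trans k.lt_succ_self), h k k.lt_succ_self⟩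

/-- Splicing two independent product samples along a predicate gives a product sample. -/
lemma infinitePi_prod_map_ite {K : Type*} (ν : Measure ℝ) [IsProbabilityMeasure ν] (p : K → Prop)
    [DecidablePred p] :
    ((Measure.infinitePi fun _ : K => ν).prod (Measure.infinitePi fun _ : K => ν)).map
        (fun z a => if p a then z.1 a else z.2 a) = Measure.infinitePi fun _ : K => ν := by
  classical
  have hm : Measurable fun (z : (K → ℝ) × (K → ℝ)) a => if p a then z.1 a else z.2 a := by
    refine measurable_pi_iff.2 fun a => ?_
    split_ifs <;> fun_prop
  refine Measure.eq_infinitePi _ fun s t ht => ?_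
  rw [Measure.map_apply hm (.pi s.countable_toSet fun _ _ => ht _)]
  have : (fun (z : (K → ℝ) × (K → ℝ)) a => if p a then z.1 a else z.2 a) ⁻¹' (Set.pi s t) =
      Set.pi (s.filter p : Finset K) t ×ˢ Set.pi (s.filter fun a => ¬ p a : Finset K) t := by
    ext z
    simp only [Set.mem_preimage, Set.mem_pi, Finset.mem_coe, Set.mem_prod, Finset.mem_filter]
    constructor
    · intro h
      refine ⟨fun a ha => ?_, fun a ha => ?_⟩
      · simpa [ha.2] using h a ha.1
      · simpa [ha.2] using h a ha.1
    · rintro ⟨h1, h2⟩ a ha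
      split_ifs with hp
      · exact h1 a ⟨ha, hp⟩
      · exact h2 a ⟨ha, hp⟩
  rw [this, Measure.prod_prod, Measure.infinitePi_pi _ fun a _ => ht a,
    Measure.infinitePi_pi _ fun a _ => ht a, Finset.prod_filter_mul_prod_filter_not]

namespace GraphArchitecture

/-- The layer of a parameter. -/
def Param.layer {G : GraphArchitecture} : G.Param → ℕ
  | .bias ℓ _ => ℓ
  | .weight ℓ _ _ _ => ℓ

variable {G : GraphArchitecture} {m n₀ : ℕ} {β : ℝ} {σ : ℝ → ℝ} {L : ℕ}

lemma affine_congr_param {w : ℕ} {θ θ' : G.Param → ℝ} (hθ : ∀ a, a.layer = L → θ a = θ' a)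
    (h : G.Site m L → ℝ) : G.affine β L w θ h = G.affine β L w θ' h := by
  funext s
  simp only [affine, W]
  rw [hθ _ rfl]
  congr! 5 with q _ j _
  exact hθ _ rfl

/-- The inputs as features of layer `0`, extended by zero to all channels. -/
def inputFeature (x : Fin m → G.Input n₀) : G.Site m 0 → ℝ := fun s =>
  if h : s.1 < n₀ then x s.2.2 s.2.1 ⟨s.1, h⟩ else 0

/-- All preactivations of layer `L + 1` for the inputs `x`. -/
noncomputable def preactField (β : ℝ) (σ : ℝ → ℝ) (x : Fin m → G.Input n₀) (n : ℕ → ℕ) (L : ℕ)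
    (θ : G.Param → ℝ) : G.Site m (L + 1) → ℝ := fun s =>
  G.preact n₀ β σ n θ (x s.2.2) L s.2.1 s.1

variable {x : Fin m → G.Input n₀} {n : ℕ → ℕ}

lemma preactField_zero (θ : G.Param → ℝ) :
    preactField β σ x n 0 θ = G.affine β 0 n₀ θ (inputFeature x) := by
  funext s
  simp only [preactField, preact, affine, Finset.sum_range, inputFeature, Fin.is_lt, dite_true,
    Fin.eta]

lemma preactField_succ (θ : G.Param → ℝ) :
    preactField β σ x n (L + 1) θ =
      G.affine β (L + 1) (n (L + 1)) θ fun s => σ (preactField β σ x n L θ s) := by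
  funext s
  simp only [preactField, preact, affine]

lemma preactField_congr {θ θ' : G.Param → ℝ} (hθ : ∀ a, a.layer ≤ L → θ a = θ' a) :
    preactField β σ x n L θ = preactField β σ x n L θ' := by
  induction L with
  | zero =>
    rw [preactField_zero, preactField_zero, affine_congr_param fun a ha => hθ a ha.le]
  | succ L ih =>
    rw [preactField_succ, preactField_succ, ih fun a ha => hθ a (ha.trans L.le_succ),
      affine_congr_param fun a ha => hθ a ha.le]

lemma measurable_preactField (hσ : Measurable σ) : Measurable (preactField β σ x n L) := by
  induction L with
  | zero =>
    simp only [funext fun θ => preactField_zero (β := β) (σ := σ) (x := x) (n := n) θ]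
    exact measurable_affine_left _
  | succ L ih =>
    rw [show preactField β σ x n (L + 1) = (fun z : (G.Site m (L + 1) → ℝ) × (G.Param → ℝ) =>
        G.affine β (L + 1) (n (L + 1)) z.2 fun s => σ (z.1 s)) ∘
          fun θ => (preactField β σ x n L θ, θ) from funext fun θ => preactField_succ θ]
    exact (measurable_affine_comp hσ).comp (ih.prodMk measurable_id)

/-- Layer `L + 1` reads only parameters of layers up to `L`, and the next step only those of layer
`L + 1`. Splicing two independent parameter samples at this level makes the independence explicit.
-/
lemma paramLaw_map_preactField_succ (hσ : Measurable σ) :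
    G.paramLaw.map (preactField β σ x n (L + 1)) =
      G.nextLaw β L (n (L + 1)) σ (G.paramLaw.map (preactField β σ x n L)) := by
  have h1 := infinitePi_prod_map_ite (gaussianReal 0 1) fun a : G.Param => a.layer ≤ L
  have hm : Measurable fun (z : (G.Param → ℝ) × (G.Param → ℝ)) (a : G.Param) =>
      if a.layer ≤ L then z.1 a else z.2 a := by
    refine measurable_pi_iff.2 fun a => ?_
    split_ifs <;> fun_prop
  have h2 : G.nextLaw β L (n (L + 1)) σ (G.paramLaw.map (preactField β σ x n L)) =
      (G.paramLaw.prod G.paramLaw).map fun z => G.affine β (L + 1) (n (L + 1)) z.2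
        fun s => σ (preactField β σ x n L z.1 s) := by
    have h3 : (G.paramLaw.map (preactField β σ x n L)).prod G.paramLaw =
        (G.paramLaw.prod G.paramLaw).map (Prod.map (preactField β σ x n L) id) := by
      rw [← Measure.map_prod_map _ _ (measurable_preactField hσ) measurable_id, Measure.map_id]
    rw [nextLaw, h3, Measure.map_map (measurable_affine_comp hσ)
      ((measurable_preactField hσ).prodMap measurable_id)]
    rfl
  rw [h2]
  conv_lhs => rw [paramLaw, ← h1]
  rw [Measure.map_map (measurable_preactField hσ) hm]
  refine congrArg (fun f => Measure.map f _) (funext fun z => ?_)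
  rw [Function.comp_apply, preactField_succ,
    preactField_congr (θ' := z.1) fun a ha => by simp [ha],
    affine_congr_param (θ' := z.2) fun a ha => by simp [ha]]

/-- The first layer is an affine layer of width `n₀` fed with deterministic features, so its
covariance is exact without any limit. -/
lemma limCov_zero : G.limCov β σ x 0 = G.condCov β 0 n₀ (inputFeature x) := by
  funext s t
  simp only [limCov, kernelSigma, condCov, Finset.sum_range, inputFeature, Fin.is_lt, dite_true,
    Fin.eta, dotProduct]
  rw [← div_div, div_mul_eq_mul_div, mul_div_assoc]
  simp only [Finset.sum_div, mul_div_assoc]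

lemma limCovPosSemidef (hβ₀ : 0 ≤ β) (hβ₁ : β ≤ 1) (hσ : Measurable σ)
    (hσ₂ : ∀ v : ℝ≥0, MemLp σ 2 (gaussianReal 0 v)) (L : ℕ) : G.LimCovPosSemidef β σ x L := by
  induction L with
  | zero =>
    classical
    intro R
    rw [limCov_zero]
    exact (paramLaw_map_affine hβ₀ hβ₁ _ fun r : R => r.1).2
  | succ L ih => exact ih.succ hβ₀ hβ₁ hσ hσ₂

/-! ### Ancestor positions and the successive limits. -/

lemma exists_positions (G : GraphArchitecture) (ℓ : ℕ) (S : Finset (G.I (ℓ + 1))) :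
    ∃ Q : ∀ L, Finset (G.I (L + 1)), S ⊆ Q ℓ ∧
      ∀ L < ℓ, ∀ p ∈ Q (L + 1), G.parents (L + 1) p ⊆ Q L := by
  classical
  induction ℓ with
  | zero => exact ⟨Function.update (fun _ => ∅) 0 S, by simp, by simp⟩
  | succ ℓ ih =>
    obtain ⟨Q, hS, hQ⟩ := ih (S.biUnion fun p => G.parents (ℓ + 1) p)
    refine ⟨Function.update Q (ℓ + 1) S, by simp, fun L hL p hp => ?_⟩
    rw [Function.update_of_ne (by omega)]
    rcases Nat.lt_succ_iff_lt_or_eq.1 hL with hL | rfl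
    · rw [Function.update_of_ne (by omega)] at hp
      exact hQ L hL p hp
    · rw [Function.update_self] at hp
      exact (Finset.subset_biUnion_of_mem (fun p => G.parents (L + 1) p) hp).trans hS

/-- The law of the preactivations of layer `L + 1` when the widths of the layers `1, …, k` are
infinite: the limiting Gaussian field up to layer `k + 1`, then a network of finite width. -/
noncomputable def partialLimitLaw (β : ℝ) (σ : ℝ → ℝ) (x : Fin m → G.Input n₀)
    (Q : ∀ L, Finset (G.I (L + 1))) (k : ℕ) (n : ℕ → ℕ) :
    (L : ℕ) → Measure (G.Site m (L + 1) → ℝ)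
  | 0 => G.gp β σ x 0 (Q 0)
  | L + 1 => if L + 1 ≤ k then G.gp β σ x (L + 1) (Q (L + 1)) else
      G.nextLaw β L (n (L + 1)) σ (partialLimitLaw β σ x Q k n L)

variable {Q : ∀ L, Finset (G.I (L + 1))} {k : ℕ}

lemma partialLimitLaw_of_le (h : L ≤ k) :
    partialLimitLaw β σ x Q k n L = G.gp β σ x L (Q L) := by
  cases L with
  | zero => rfl
  | succ L => rw [partialLimitLaw, if_pos h]

lemma partialLimitLaw_succ (h : k ≤ L) :
    partialLimitLaw β σ x Q k n (L + 1) =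
      G.nextLaw β L (n (L + 1)) σ (partialLimitLaw β σ x Q k n L) := by
  rw [partialLimitLaw, if_neg (by omega)]

lemma isProbabilityMeasure_partialLimitLaw (hσ : Measurable σ) :
    IsProbabilityMeasure (partialLimitLaw β σ x Q k n L) := by
  induction L with
  | zero => rw [partialLimitLaw]; infer_instance
  | succ L ih =>
    rw [partialLimitLaw]
    split_ifs
    · infer_instance
    · exact isProbabilityMeasure_nextLaw hσ _

/-- Both sequences are constant, so this is equality on cylinder events; in this form the induction
step is again `cylinderConv_nextLaw`. -/
lemma cylinderConv_preactField (hβ₀ : 0 ≤ β) (hβ₁ : β ≤ 1) (hσ : Measurable σ)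
    (hσ₂ : ∀ v : ℝ≥0, MemLp σ 2 (gaussianReal 0 v))
    (hQ : ∀ l < L, ∀ p ∈ Q (l + 1), G.parents (l + 1) p ⊆ Q l) :
    CylinderConv {s | s.2.1 ∈ Q L} (fun _ => partialLimitLaw β σ x Q 0 n L)
      (G.paramLaw.map (preactField β σ x n L)) := by
  induction L with
  | zero =>
    classical
    intro R A hR hA hRA
    obtain ⟨B, hB, hAB⟩ := exists_marginal_event hA hRA
    have h1 := gp_marginal (limCovPosSemidef (x := x) hβ₀ hβ₁ hσ hσ₂ 0) (Q := Q 0)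
      (s := fun r : R => r.1) fun r => hR r.2
    rw [limCov_zero, ← (paramLaw_map_affine hβ₀ hβ₁ _ fun r : R => r.1).1] at h1
    have h2 := congrArg (fun μ => μ B) h1
    have hm := measurable_affine_left (β := β) (w := n₀) (inputFeature x)
    simp only [Measure.map_apply (show Measurable fun φ : G.Site m 1 → ℝ =>
      (WithLp.toLp 2 fun r : R => φ r.1 : EuclideanSpace ℝ R) by fun_prop) hB,
      Measure.map_apply (show Measurable fun θ : G.Param → ℝ =>
      (WithLp.toLp 2 fun r : R => G.affine β 0 n₀ θ (inputFeature x) r.1 : EuclideanSpace ℝ R)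
        by fun_prop) hB] at h2
    have hA' : A = (fun ψ : G.Site m 1 → ℝ => WithLp.toLp 2 fun r : R => ψ r.1) ⁻¹' B :=
      Set.ext hAB
    simp only [partialLimitLaw]
    rw [Measure.map_apply (measurable_preactField hσ) hA, hA', h2]
    simp only [← Set.preimage_comp, Function.comp_def, preactField_zero]
    exact tendsto_const_nhds
  | succ L ih =>
    have := fun n' => isProbabilityMeasure_partialLimitLaw (β := β) (x := x) (Q := Q) (k := 0)
      (n := n') (L := L) hσ
    have : IsProbabilityMeasure (G.paramLaw.map (preactField β σ x n L)) :=
      Measure.isProbabilityMeasure_map (measurable_preactField hσ).aemeasurable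
    simp only [partialLimitLaw_succ (Nat.zero_le L), paramLaw_map_preactField_succ hσ]
    exact cylinderConv_nextLaw hσ (hQ L L.lt_succ_self) (ih fun l hl => hQ l (hl.trans L.lt_succ_self))

/-- Below the layer whose width varies nothing changes; the field it feeds converges by
`cylinderConv_gp`; every later layer transports the convergence. -/
lemma cylinderConv_partialLimitLaw (hβ₀ : 0 ≤ β) (hβ₁ : β ≤ 1) (hσ : Measurable σ)
    (hσ₂ : ∀ v : ℝ≥0, MemLp σ 2 (gaussianReal 0 v))
    (hQ : ∀ l < L, ∀ p ∈ Q (l + 1), G.parents (l + 1) p ⊆ Q l) :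
    CylinderConv {s | s.2.1 ∈ Q L}
      (fun w => partialLimitLaw β σ x Q k (Function.update n (k + 1) w) L)
      (partialLimitLaw β σ x Q (k + 1) n L) := by
  induction L with
  | zero => exact CylinderConv.const _ _
  | succ L ih =>
    rcases lt_trichotomy L k with h | rfl | h
    · simp only [partialLimitLaw_of_le (show L + 1 ≤ k by omega),
        partialLimitLaw_of_le (show L + 1 ≤ k + 1 by omega)]
      exact CylinderConv.const _ _
    · simp only [partialLimitLaw_succ le_rfl, partialLimitLaw_of_le le_rfl, Function.update_self]
      exact cylinderConv_gp hβ₀ hβ₁ (limCovPosSemidef hβ₀ hβ₁ hσ hσ₂ L) hσ hσ₂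
        (hQ L L.lt_succ_self)
    · have := fun k' n' => isProbabilityMeasure_partialLimitLaw (β := β) (x := x) (Q := Q)
        (k := k') (n := n') (L := L) hσ
      simp only [partialLimitLaw_succ h.le, partialLimitLaw_succ (Nat.succ_le_of_lt h),
        Function.update_of_ne (show L + 1 ≠ k + 1 by omega)]
      exact cylinderConv_nextLaw hσ (hQ L L.lt_succ_self)
        (ih fun l hl => hQ l (hl.trans L.lt_succ_self))

/-- The joint law of preactivations is that for canonical i.i.d. Gaussian parameters. -/
lemma coe_preactLaw (hσ : Measurable σ) {Ω : Type*} [MeasurableSpace Ω] {P : Measure Ω}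
    [IsProbabilityMeasure P] {θ : G.Param → Ω → ℝ} (hθ_indep : iIndepFun θ P)
    (hθ_law : ∀ a, HasLaw (θ a) (gaussianReal 0 1) P) (i : Fin m → ℕ) (p : Fin m → G.I (L + 1)) :
    (G.preactLaw n₀ β hσ (fun a => (hθ_law a).aemeasurable) L i p x n :
        Measure (EuclideanSpace ℝ (Fin m))) =
      (G.paramLaw.map (preactField β σ x n L)).map
        fun φ => WithLp.toLp 2 fun a => φ (i a, p a, a) := by
  let θ' : G.Param → Ω → ℝ := fun a => (hθ_law a).aemeasurable.mk
  have hm : ∀ a, Measurable (θ' a) := fun a => (hθ_law a).aemeasurable.measurable_mk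
  have hae : ∀ a, θ a =ᵐ[P] θ' a := fun a => (hθ_law a).aemeasurable.ae_eq_mk
  have hpre : ∀ (l : ℕ) (s : G.Site m (l + 1)), ∀ᵐ ω ∂P,
      preactField β σ x n l (fun b => θ b ω) s = preactField β σ x n l (fun b => θ' b ω) s := by
    -- There may be uncountably many parameters, so the modifications agree almost surely only at
    -- one site at a time, where countably many are read. The features `h` are quantified inside the
    -- almost sure event because they will be random.
    have haff : ∀ (l w : ℕ) (s : G.Site m (l + 1)), ∀ᵐ ω ∂P, ∀ h : G.Site m l → ℝ,
        G.affine β l w (fun b => θ b ω) h s = G.affine β l w (fun b => θ' b ω) h s := by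
      intro l w s
      filter_upwards [hae (.bias l s.1), ae_all_iff.2 fun q => ae_all_iff.2 fun j =>
        hae (.weight l (Quotient.mk (G.share l) ⟨s.2.1, q⟩) s.1 j)] with ω h1 h2 h
      simp only [affine, W, h1, h2]
    intro l
    induction l with
    | zero =>
      intro s
      filter_upwards [haff 0 n₀ s] with ω h
      rw [preactField_zero, preactField_zero, h]
    | succ l ih =>
      intro s
      filter_upwards [haff (l + 1) (n (l + 1)) s,
        ae_all_iff.2 fun q : {q // q ∈ G.parents (l + 1) s.2.1} => ae_all_iff.2 fun j =>
          ih (j, q, s.2.2)] with ω h1 h2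
      rw [preactField_succ, preactField_succ, h1]
      exact affine_congr _ fun j _ q hq => congrArg σ (h2 ⟨q, hq⟩ j)
  have hlaw : P.map (fun ω a => θ' a ω) = G.paramLaw := by
    rw [(hθ_indep.congr hae).map_fun_eq_infinitePi_map hm, paramLaw]
    congr 1
    funext a
    rw [← Measure.map_congr (hae a), (hθ_law a).map_eq]
  rw [← hlaw, Measure.map_map (measurable_preactField hσ) (measurable_pi_iff.2 hm),
    Measure.map_map (by fun_prop) ((measurable_preactField hσ).comp (measurable_pi_iff.2 hm))]
  refine Measure.map_congr ?_
  filter_upwards [ae_all_iff.2 fun a => hpre L (i a, p a, a)] with ω hω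
  exact congrArg (WithLp.toLp 2) (funext hω)

end GraphArchitecture

theorem mainTheorem6
    (G : GraphArchitecture) (n₀ : ℕ) (β : ℝ) (hβ₀ : 0 ≤ β) (hβ₁ : β ≤ 1)
    (σ : ℝ → ℝ) (hσ : Measurable σ) (hσ₂ : ∀ v : ℝ≥0, MemLp σ 2 (gaussianReal 0 v))
    {Ω : Type*} [MeasurableSpace Ω] (P : Measure Ω) [IsProbabilityMeasure P]
    (θ : G.Param → Ω → ℝ) (hθ_indep : iIndepFun θ P)
    (hθ_law : ∀ a, HasLaw (θ a) (gaussianReal 0 1) P)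
    (ℓ m : ℕ) (i : Fin m → ℕ) (p : Fin m → G.I (ℓ + 1)) (x : Fin m → G.Input n₀) :
    (G.covMatrix n₀ β σ ℓ i p x).PosSemidef ∧
      HasSequentialLimit ℓ
        (G.preactLaw n₀ β hσ (fun a => (hθ_law a).aemeasurable) ℓ i p x)
        (fun _ => centeredGaussian (G.covMatrix n₀ β σ ℓ i p x)) := by
  classical
  have hPSD := GraphArchitecture.limCovPosSemidef (G := G) (x := x) hβ₀ hβ₁ hσ hσ₂ ℓ
  refine ⟨hPSD.comp fun a => (i a, p a, a), ?_⟩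
  obtain ⟨Q, hp, hQ⟩ := G.exists_positions ℓ (Finset.univ.image p)
  have hpQ : ∀ a, p a ∈ Q ℓ := fun a => hp (Finset.mem_image_of_mem p (Finset.mem_univ a))
  have hprob := fun k n => GraphArchitecture.isProbabilityMeasure_partialLimitLaw
    (β := β) (x := x) (Q := Q) (k := k) (n := n) (L := ℓ) hσ
  let K : ℕ → (ℕ → ℕ) → ProbabilityMeasure (EuclideanSpace ℝ (Fin m)) := fun k n =>
    ⟨(GraphArchitecture.partialLimitLaw β σ x Q k n ℓ).map
      fun φ => WithLp.toLp 2 fun a => φ (i a, p a, a),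
      Measure.isProbabilityMeasure_map (Measurable.aemeasurable (by fun_prop))⟩
  -- Two laws that agree on cylinders are both weak limits of the same constant sequence.
  have h0 : G.preactLaw n₀ β hσ (fun a => (hθ_law a).aemeasurable) ℓ i p x = K 0 := by
    funext n
    exact tendsto_nhds_unique
      ((GraphArchitecture.cylinderConv_preactField hβ₀ hβ₁ hσ hσ₂ hQ).tendsto_marginal
        (s := fun a => (i a, p a, a)) hpQ (K := fun _ => K 0 n) (fun _ => rfl)
        (GraphArchitecture.coe_preactLaw hσ hθ_indep hθ_law i p)) tendsto_const_nhds
  have hℓ : (fun _ => centeredGaussian (G.covMatrix n₀ β σ ℓ i p x)) = K ℓ := by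
    funext n
    refine Subtype.ext ?_
    change _ = (GraphArchitecture.partialLimitLaw β σ x Q ℓ n ℓ).map _
    rw [GraphArchitecture.partialLimitLaw_of_le le_rfl,
      GraphArchitecture.gp_marginal hPSD (s := fun a => (i a, p a, a)) hpQ]
    rfl
  rw [h0, hℓ]
  refine hasSequentialLimit_of_tendsto K ℓ fun k _ n => ?_
  exact (GraphArchitecture.cylinderConv_partialLimitLaw hβ₀ hβ₁ hσ hσ₂ hQ).tendsto_marginal
    (s := fun a => (i a, p a, a)) hpQ (fun _ => rfl) rfl
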